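/- For a Boolean function $f:\{0,1\}^n\to\{0,1\}$ let $\hat f(a)=2^{-n}\sum_{x}(-1)^{f(x)\oplus a\cdot x}$ for $a\in\{0,1\}^n$, let $\hat f_{\max}=\max_a|\hat f(a)|$, and let $\eta_f=\tfrac12-\tfrac12\hat f_{\max}$ be the non-linearity of $f$. Consider quantum query algorithms that act on finitely many qubits, all initialised to $0$, and proceed by unitaries that do not depend on $f$, calls to the oracle $|x\rangle|b\rangle\mapsto|x\rangle|b\oplus f(x)\rangle$, and intermediate measurements in the computational basis whose outcomes may determine the later steps, the moment of halting and the real number that is output. Then there is a universal constant $C>0$ such that for every $n\ge 0$, every accuracy $\lambda\in(0,1)$ and every error parameter $\delta\in(0,\tfrac12)$ there is such an algorithm, depending only on $n,\lambda,\delta$, with the following property for every $f:\{0,1\}^n\to\{0,1\}$. When the algorithm is run with the oracle of $f$ (without knowing $\hat f_{\max}$), then with probability at least $1-\delta$ it outputs an estimate $\tilde\eta_f$ with $|\eta_f-\tilde\eta_f|\le\lambda$ and makes at most $$C\cdot\frac{1}{\lambda\,\hat f_{\max}}\,\log\Big(\frac1\lambda\Big)\,\log\Big(\frac{1}{\delta\,\hat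 f_{\max}}\Big)$$ calls to the oracle. -/

import Mathlib

/-- The Walsh-Hadamard coefficient
`f̂(a) = 2⁻ⁿ ∑ₓ (-1)^(f(x) + a·x)` of a Boolean function on `n` bits. -/
noncomputable def walshCoeff {n : ℕ} (f : (Fin n → Bool) → Bool) (a : Fin n → Bool) : ℝ :=
  (∑ x : Fin n → Bool, (-1 : ℝ) ^ ((f x).toNat + ∑ i, (a i && x i).toNat)) / 2 ^ n

/-- The largest absolute value of a Walsh-Hadamard coefficient. -/
noncomputable def walshMax {n : ℕ} (f : (Fin n → Bool) → Bool) : ℝ :=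
  Finset.univ.sup' Finset.univ_nonempty (fun a : Fin n → Bool => |walshCoeff f a|)

/-- The non-linearity of a Boolean function. -/
noncomputable def nonlinearity {n : ℕ} (f : (Fin n → Bool) → Bool) : ℝ :=
  1 / 2 - walshMax f / 2

/-- Labels of the computational basis of `n` query qubits, one target qubit and `w` work qubits. -/
abbrev QBasis (n w : ℕ) : Type := (Fin n → Bool) × Bool × (Fin w → Bool)

/-- State vectors (possibly unnormalized) in the computational basis. -/
abbrev QState (n w : ℕ) : Type := QBasis n w → ℂ

/-- Squared Euclidean norm of a state vector. -/
noncomputable def QState.weight {n w : ℕ} (ψ : QState n w) : ℝ := ∑ i, ‖ψ i‖ ^ 2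

/-- The basis state with all qubits equal to `0`. -/
def QState.init (n w : ℕ) : QState n w :=
  Pi.single ((fun _ => false, false, fun _ => false) : QBasis n w) 1

/-- One call to the oracle of `f`, the unitary `|x⟩|b⟩|z⟩ ↦ |x⟩|b ⊕ f(x)⟩|z⟩`. -/
def QState.oracle {n w : ℕ} (f : (Fin n → Bool) → Bool) (ψ : QState n w) : QState n w :=
  fun i => ψ (i.1, xor i.2.1 (f i.1), i.2.2)

/-- The projection of a state onto the span of the basis states with label `j`. -/
def QState.project {n w k : ℕ} (lab : QBasis n w → Fin k) (j : Fin k) (ψ : QState n w) :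
    QState n w :=
  fun i => if lab i = j then ψ i else 0

/-- Quantum query algorithms with intermediate measurements and classical control, on `n` query
qubits, one target qubit and `w` work qubits. The algorithm may halt with a real output, apply a
fixed unitary, call the oracle, or measure a function `lab` of the computational basis
and continue in a way that depends on the observed outcome. The algorithm has no access to the
Boolean function other than its oracle calls. -/
inductive QueryAlgorithm (n w : ℕ) : Type
  | halt (r : ℝ) : QueryAlgorithm n w
  | gate (U : Matrix.unitaryGroup (QBasis n w) ℂ) (next : QueryAlgorithm n w) : QueryAlgorithm n w
  | query (next : QueryAlgorithm n w) : QueryAlgorithm n w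
  | measure (k : ℕ) (lab : QBasis n w → Fin k) (next : Fin k → QueryAlgorithm n w) :
      QueryAlgorithm n w

open Matrix in
/-- `A.probFrom f E ψ q` is the probability (weight, by the Born rule) with which `A`, started in
the state `ψ` after `q` oracle calls have been made, halts with an output `r` and a total number
`t` of oracle calls such that `(r, t) ∈ E`, when the oracle is that of `f`. -/
noncomputable def QueryAlgorithm.probFrom {n w : ℕ} (f : (Fin n → Bool) → Bool)
    (E : Set (ℝ × ℕ)) : QueryAlgorithm n w → QState n w → ℕ → ℝ
  | .halt r, ψ, q => E.indicator (fun _ => QState.weight ψ) (r, q)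
  | .gate U next, ψ, q => probFrom f E next ((U : Matrix (QBasis n w) (QBasis n w) ℂ) *ᵥ ψ) q
  | .query next, ψ, q => probFrom f E next (QState.oracle f ψ) (q + 1)
  | .measure _ lab next, ψ, q => ∑ j, probFrom f E (next j) (QState.project lab j ψ) q

/-- The probability that `A`, run on the all-zero state with the oracle of `f`, halts with an
output `r` and a total number `t` of oracle calls such that `(r, t) ∈ E`. -/
noncomputable def QueryAlgorithm.prob {n w : ℕ} (A : QueryAlgorithm n w)
    (f : (Fin n → Bool) → Bool) (E : Set (ℝ × ℕ)) : ℝ :=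
  A.probFrom f E (QState.init n w) 0

/-! Write `walshMax f = sin θ` with `θ` in `[0, π/2]`. It suffices to locate `θ` up to an error of
order `lam`, by shrinking an interval `[u - L, u]` that contains it. The coherent test of
`exists_test_circuit` tells the top `1/128` of the interval from the bottom `1/128`; in between
either answer is harmless, so each test removes one of the two ends and keeps the fraction
`127/128`.

The test rests on the state `∑ₐ f̂(a)|a⟩`, which costs one query. For each label `a` a walk built
from reflections has phases `±2ψ`, where `f̂(a)² = sin² ψ`; a window of about `1/L` walk steps near
the top of the interval accepts `a` with a probability given by Fejér kernels
(`exists_bump_circuit`). A vote over `O(log(1/L))` copies pushes wrong acceptance below a multiple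
of `u²` (`exists_filter_circuit`). If `θ` is near the top, a maximizing label alone contributes
flagged weight of order `u²`; if `θ` is near the bottom, all labels together contribute a much
smaller multiple of `u²`. Amplitude amplification with `O(1/u)` uses, followed by a second vote,
separates the cases (`exists_vote_circuit`).

A test thus costs `O(1/(u L))` up to logarithms. As long as the answers are right, `u ≥ θ ≥ walshMax
f`, so the cost is at most of order `1/(L * walshMax f)` although `walshMax f` is unknown. The
lengths `L` are geometric, hence the last tests dominate the total, and failure probabilities that
halve from level to level keep the sum finite without another logarithm (`exists_search`). The
argument yields the factor `log(1/δ)`, which is at most the stated `log(1/(δ * walshMax f))`. -/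

open Matrix

set_option linter.unusedSectionVars false

/-! ### Unitary matrices -/

/-- The matrix of the tensor product of a finite family of matrices. -/
def Matrix.piKron {ι Y : Type*} [Fintype ι] (S : ι → Matrix Y Y ℂ) : Matrix (ι → Y) (ι → Y) ℂ :=
  fun y y' => ∏ i, S i (y i) (y' i)

section Unitary

variable {ι Y : Type*} [Fintype ι] [DecidableEq ι] [Fintype Y] [DecidableEq Y]

lemma Matrix.piKron_mul (S T : ι → Matrix Y Y ℂ) :
    piKron S * piKron T = piKron (fun i => S i * T i) := by
  ext y y'
  simp only [piKron, Matrix.mul_apply, ← Finset.prod_mul_distrib]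
  rw [Finset.prod_univ_sum]
  simp

lemma Matrix.piKron_diagonal (d : ι → Y → ℂ) :
    piKron (fun i => diagonal (d i)) = diagonal fun y => ∏ i, d i (y i) := by
  ext y y'
  by_cases h : y = y'
  · subst h; simp [piKron]
  · obtain ⟨i, hi⟩ := Function.ne_iff.1 h
    rw [diagonal_apply_ne _ h]
    exact Finset.prod_eq_zero (Finset.mem_univ i) (diagonal_apply_ne _ hi)

lemma Matrix.piKron_one : piKron (fun _ : ι => (1 : Matrix Y Y ℂ)) = 1 := by
  simp [← diagonal_one, piKron_diagonal]

lemma Matrix.star_piKron (S : ι → Matrix Y Y ℂ) : star (piKron S) = piKron fun i => star (S i) := by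
  ext y y'
  simp [piKron, star_apply]

lemma Matrix.piKron_mem_unitary {S : ι → Matrix Y Y ℂ} (h : ∀ i, S i ∈ unitaryGroup Y ℂ) :
    piKron S ∈ unitaryGroup (ι → Y) ℂ := by
  rw [mem_unitaryGroup_iff, star_piKron, piKron_mul]
  simp [fun i => mem_unitaryGroup_iff.1 (h i), piKron_one]

lemma Matrix.diagonal_mem_unitary {d : Y → ℂ} (h : ∀ y, ‖d y‖ = 1) :
    diagonal d ∈ unitaryGroup Y ℂ := by
  rw [mem_unitaryGroup_iff, star_eq_conjTranspose, diagonal_conjTranspose, diagonal_mul_diagonal,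
    ← diagonal_one]
  congr 1
  ext y
  simp [Complex.mul_conj, Complex.normSq_eq_norm_sq, h]

lemma Matrix.sum_norm_sq_col {U : Matrix Y Y ℂ} (hU : U ∈ unitaryGroup Y ℂ) (z : Y) :
    ∑ y, ‖U y z‖ ^ 2 = 1 := by
  have h := congrFun (congrFun (mem_unitaryGroup_iff'.1 hU) z) z
  simp only [Matrix.mul_apply, star_apply, one_apply_eq] at h
  have h2 : ((∑ y, ‖U y z‖ ^ 2 : ℝ) : ℂ) = 1 := by
    rw [← h]
    push_cast
    refine Finset.sum_congr rfl fun y _ => ?_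
    rw [← Complex.conj_mul']
    rfl
  exact_mod_cast h2

/-- The block diagonal matrix with blocks indexed by a control register. -/
def Matrix.controlled {B : Type*} [DecidableEq B] (S : B → Matrix Y Y ℂ) :
    Matrix (B × Y) (B × Y) ℂ :=
  fun z z' => if z.1 = z'.1 then S z.1 z.2 z'.2 else 0

section controlled
variable {B : Type*} [DecidableEq B]

lemma Matrix.controlled_mul [Fintype B] (S T : B → Matrix Y Y ℂ) :
    controlled S * controlled T = controlled (fun b => S b * T b) := by
  ext ⟨b, y⟩ ⟨b', y'⟩
  simp only [controlled, Matrix.mul_apply, Fintype.sum_prod_type]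
  by_cases h : b = b'
  · subst h
    rw [Finset.sum_eq_single b]
    · simp
    · intro c _ hc
      simp [hc]
    · simp
  · rw [if_neg h]
    refine Finset.sum_eq_zero fun c _ => Finset.sum_eq_zero fun _ _ => ?_
    by_cases h1 : b = c
    · subst h1; simp [h]
    · simp [h1]

lemma Matrix.controlled_diagonal (d : B → Y → ℂ) :
    controlled (fun b => diagonal (d b)) = diagonal fun z => d z.1 z.2 := by
  ext ⟨b, y⟩ ⟨b', y'⟩
  simp only [controlled, diagonal_apply, Prod.mk.injEq]
  by_cases h : b = b' <;> by_cases h' : y = y' <;> simp [h, h']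

lemma Matrix.star_controlled (S : B → Matrix Y Y ℂ) :
    star (controlled S) = controlled fun b => star (S b) := by
  ext ⟨b, y⟩ ⟨b', y'⟩
  simp only [controlled, star_apply]
  by_cases h : b = b'
  · subst h; simp
  · simp [h, Ne.symm h]

lemma Matrix.controlled_mem_unitary [Fintype B] {S : B → Matrix Y Y ℂ}
    (h : ∀ b, S b ∈ unitaryGroup Y ℂ) : controlled S ∈ unitaryGroup (B × Y) ℂ := by
  rw [mem_unitaryGroup_iff, star_controlled, controlled_mul]
  simp only [fun b => mem_unitaryGroup_iff.1 (h b), ← diagonal_one]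
  rw [controlled_diagonal]

end controlled

/-- Every orthonormal family extends to a unitary matrix with prescribed columns. -/
lemma Matrix.exists_unitary_extends {Z : Type*} [DecidableEq Z] (j : Z → Y) (hj : Function.Injective j)
    (v : Z → Y → ℂ)
    (hv : ∀ z z', ∑ y, star (v z y) * v z' y = if z = z' then 1 else 0) :
    ∃ U ∈ unitaryGroup Y ℂ, ∀ z y, U y (j z) = v z y := by
  have hon : Orthonormal ℂ (Function.extend j (fun z => (WithLp.toLp 2 (v z) : EuclideanSpace ℂ Y))
      0 ∘ ((↑) : Set.range j → Y)) := by
    rw [orthonormal_iff_ite]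
    rintro ⟨_, z, rfl⟩ ⟨_, z', rfl⟩
    have e : ((⟨j z, ⟨z, rfl⟩⟩ : Set.range j) = ⟨j z', ⟨z', rfl⟩⟩) = (z = z') :=
      propext (Subtype.ext_iff.trans hj.eq_iff)
    have h := hv z z'
    simp only [Function.comp, hj.extend_apply, EuclideanSpace.inner_eq_star_dotProduct]
    trans if z = z' then 1 else 0
    · rw [← h]
      simp [dotProduct, mul_comm]
    · by_cases hz : z = z'
      · rw [if_pos hz, if_pos (e.mpr hz)]
      · rw [if_neg hz, if_neg fun h' => hz (e.mp h')]
  obtain ⟨b, hb⟩ := Orthonormal.exists_orthonormalBasis_extension_of_card_eq (by simp) hon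
  refine ⟨(EuclideanSpace.basisFun Y ℂ).toBasis.toMatrix b,
    OrthonormalBasis.toMatrix_orthonormalBasis_mem_unitary _ _, fun z y => ?_⟩
  have := hb (j z) ⟨z, rfl⟩
  rw [hj.extend_apply] at this
  simp [Module.Basis.toMatrix_apply, this]

/-- Every unit vector is a prescribed column of a unitary matrix. -/
lemma Matrix.exists_unitary_col (z : Y) (v : Y → ℂ) (hv : ∑ y, ‖v y‖ ^ 2 = 1) :
    ∃ U ∈ unitaryGroup Y ℂ, ∀ y, U y z = v y := by
  obtain ⟨U, hU, h⟩ := exists_unitary_extends (fun _ : Unit => z)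
    (fun _ _ _ => rfl) (fun _ => v) (fun _ _ => by
      simp only [if_true]
      have : ((∑ y, ‖v y‖ ^ 2 : ℝ) : ℂ) = 1 := by rw [hv]; simp
      rw [← this]
      push_cast
      refine Finset.sum_congr rfl fun y _ => ?_
      rw [← Complex.conj_mul']
      rfl)
  exact ⟨U, hU, h ()⟩

end Unitary

/-! ### Query circuits -/

/-- The diagonal matrix of one phase query. -/
def phaseMatrix {n : ℕ} {Y : Type*} [DecidableEq Y] (x : Y → Fin n → Bool) (c : Y → Bool)
    (f : (Fin n → Bool) → Bool) : Matrix Y Y ℂ :=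
  diagonal fun y => if c y && f (x y) then -1 else 1

/-- `QueryCircuit n A Y q S` says that the family `S a f` of unitary matrices, controlled by `a`,
is a product of gates that do not depend on `f` and of `q` phase queries to `f`. -/
inductive QueryCircuit (n : ℕ) (A Y : Type) [Fintype Y] [DecidableEq Y] :
    ℕ → (A → ((Fin n → Bool) → Bool) → Matrix Y Y ℂ) → Prop
  | gate (U : A → Matrix Y Y ℂ) (hU : ∀ a, U a ∈ unitaryGroup Y ℂ) :
      QueryCircuit n A Y 0 fun a _ => U a
  | query (x : A → Y → Fin n → Bool) (c : A → Y → Bool) :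
      QueryCircuit n A Y 1 fun a f => phaseMatrix (x a) (c a) f
  | mul {p q : ℕ} {S T : A → ((Fin n → Bool) → Bool) → Matrix Y Y ℂ}
      (hS : QueryCircuit n A Y p S) (hT : QueryCircuit n A Y q T) :
      QueryCircuit n A Y (p + q) fun a f => S a f * T a f

lemma phaseMatrix_mem_unitary {n : ℕ} {Y : Type*} [Fintype Y] [DecidableEq Y]
    (x : Y → Fin n → Bool) (c : Y → Bool) (f : (Fin n → Bool) → Bool) :
    phaseMatrix x c f ∈ unitaryGroup Y ℂ := by
  refine diagonal_mem_unitary fun y => ?_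
  split_ifs <;> simp

namespace QueryCircuit

variable {n : ℕ} {A Y : Type} [Fintype Y] [DecidableEq Y]
  {q : ℕ} {S : A → ((Fin n → Bool) → Bool) → Matrix Y Y ℂ}

lemma mem_unitary (h : QueryCircuit n A Y q S) (a : A) (f : (Fin n → Bool) → Bool) :
    S a f ∈ unitaryGroup Y ℂ := by
  induction h with
  | gate U hU => exact hU a
  | query x c => exact phaseMatrix_mem_unitary _ _ _
  | mul _ _ h1 h2 => exact mul_mem h1 h2

lemma star (h : QueryCircuit n A Y q S) : QueryCircuit n A Y q fun a f => star (S a f) := by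
  induction h with
  | gate U hU => exact gate (fun a => Star.star (U a)) fun a => Unitary.star_mem (hU a)
  | query x c =>
    convert query (n := n) x c using 3 with a f
    simp only [phaseMatrix]
    rw [star_eq_conjTranspose, diagonal_conjTranspose]
    congr 1
    ext y
    simp only [Pi.star_apply]
    split_ifs <;> simp
  | mul _ _ h1 h2 =>
    simp only [star_mul]
    rw [add_comm]
    exact mul h2 h1

lemma one : QueryCircuit n A Y 0 fun _ _ => 1 := gate (fun _ => 1) fun _ => one_mem _

/-- A control register may be made part of the state. -/
lemma uncurry {B : Type} [Fintype B] [DecidableEq B]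
    {S : A × B → ((Fin n → Bool) → Bool) → Matrix Y Y ℂ}
    (h : QueryCircuit n (A × B) Y q S) :
    QueryCircuit n A (B × Y) q fun a f => controlled fun b => S (a, b) f := by
  induction h with
  | gate U hU =>
    exact gate (fun a => controlled fun b => U (a, b)) fun a =>
      controlled_mem_unitary fun b => hU (a, b)
  | query x c =>
    convert query (n := n) (A := A) (Y := B × Y) (fun a z => x (a, z.1) z.2)
      (fun a z => c (a, z.1) z.2) using 3 with a f
    simp only [phaseMatrix]
    rw [controlled_diagonal]
  | mul _ _ h1 h2 =>
    simp only [← controlled_mul]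
    exact mul h1 h2

/-- A circuit may be run in one of several registers. -/
lemma single {ι : Type} [Fintype ι] [DecidableEq ι] (i : ι) (h : QueryCircuit n A Y q S) :
    QueryCircuit n A (ι → Y) q fun a f => piKron fun j => if j = i then S a f else 1 := by
  induction h with
  | gate U hU =>
    refine gate (fun a => piKron fun j => if j = i then U a else 1) fun a =>
      piKron_mem_unitary fun j => ?_
    split_ifs
    · exact hU a
    · exact one_mem _
  | query x c =>
    convert query (n := n) (A := A) (Y := ι → Y) (fun a y => x a (y i))
      (fun a y => c a (y i)) using 3 with a f
    simp only [phaseMatrix]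
    have : (fun j => if j = i then diagonal (fun y => if (c a y && f (x a y)) = true then (-1 : ℂ)
        else 1) else 1) = fun j => diagonal (fun y => if j = i then
          (if (c a y && f (x a y)) = true then (-1 : ℂ) else 1) else 1) := by
      ext j : 1
      split_ifs <;> simp
    rw [this, piKron_diagonal]
    congr 1
    ext y
    simp
  | mul _ _ h1 h2 =>
    convert mul h1 h2 using 3 with a f
    rw [piKron_mul]
    congr 1
    ext j : 1
    split_ifs <;> simp

/-- Circuits may be run in parallel in separate registers. -/
lemma parallel {ι : Type} [Fintype ι] [DecidableEq ι] {q : ι → ℕ}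
    {S : ι → A → ((Fin n → Bool) → Bool) → Matrix Y Y ℂ}
    (h : ∀ i, QueryCircuit n A Y (q i) (S i)) :
    QueryCircuit n A (ι → Y) (∑ i, q i) fun a f => piKron fun i => S i a f := by
  have key : ∀ s : Finset ι, QueryCircuit n A (ι → Y) (∑ i ∈ s, q i)
      fun a f => piKron fun i => if i ∈ s then S i a f else 1 := by
    intro s
    induction s using Finset.induction_on with
    | empty => simpa [piKron_one] using one
    | insert i s hi ih =>
      rw [Finset.sum_insert hi]
      convert mul (single i (h i)) ih using 3 with a f
      rw [piKron_mul]
      congr 1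
      ext j : 1
      by_cases hj : j = i
      · subst hj; simp [hi]
      · simp [hj]
  simpa using key Finset.univ

end QueryCircuit

/-! ### Running query circuits on a quantum query algorithm -/

section Realization

variable {n w : ℕ}

lemma QState.weight_smul (c : ℂ) (ψ : QState n w) :
    QState.weight (c • ψ) = ‖c‖ ^ 2 * QState.weight ψ := by
  simp [QState.weight, Finset.mul_sum, mul_pow]

/-- Projected states are not renormalized, so the probability of a branch enters as the squared norm
of a scalar. -/
lemma QueryAlgorithm.probFrom_smul (f : (Fin n → Bool) → Bool) (E : Set (ℝ × ℕ))
    (A : QueryAlgorithm n w) (c : ℂ) (ψ : QState n w) (q : ℕ) :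
    A.probFrom f E (c • ψ) q = ‖c‖ ^ 2 * A.probFrom f E ψ q := by
  induction A generalizing ψ q with
  | halt r =>
    simp only [probFrom, QState.weight_smul, Set.indicator]
    split_ifs <;> simp
  | gate U next ih => simp only [probFrom, mulVec_smul, ih]
  | query next ih => exact ih _ _
  | measure k lab next ih =>
    simp only [probFrom, Finset.mul_sum, ← ih]
    refine Finset.sum_congr rfl fun j _ => ?_
    congr 1
    ext i
    simp [QState.project]

lemma QueryAlgorithm.probFrom_nonneg (f : (Fin n → Bool) → Bool) (E : Set (ℝ × ℕ))
    (A : QueryAlgorithm n w) (ψ : QState n w) (q : ℕ) : 0 ≤ A.probFrom f E ψ q := by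
  induction A generalizing ψ q with
  | halt r => exact Set.indicator_nonneg (fun _ _ => Finset.sum_nonneg fun _ _ => by positivity) _
  | gate U next ih => exact ih _ _
  | query next ih => exact ih _ _
  | measure k lab next ih => exact Finset.sum_nonneg fun j _ => ih _ _ _

variable {Y : Type} [Fintype Y] [DecidableEq Y]

/-- The basis state in which only the work register is not zero. -/
def QBasis.work (z : Fin w → Bool) : QBasis n w := (fun _ => false, false, z)

lemma QBasis.work_injective : Function.Injective (QBasis.work (n := n) (w := w)) := by
  intro z z' h
  simpa [QBasis.work] using h

lemma Matrix.mulVec_sum_smul {I : Type*} [Fintype I] [DecidableEq I] (U : Matrix I I ℂ)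
    (ψ : Y → ℂ) (v : Y → I → ℂ) : U *ᵥ (∑ y, ψ y • v y) = ∑ y, ψ y • (U *ᵥ v y) := by
  simp [mulVec_sum, mulVec_smul]

/-- The state of the work register encoded by `ι`. -/
noncomputable def QState.embed (ι : Y → Fin w → Bool) (ψ : Y → ℂ) : QState n w :=
  ∑ y, ψ y • Pi.single (QBasis.work (ι y)) 1

lemma QState.embed_work {ι : Y → Fin w → Bool} (hι : Function.Injective ι) (ψ : Y → ℂ) (y : Y) :
    (QState.embed ι ψ : QState n w) (QBasis.work (ι y)) = ψ y := by
  simp [QState.embed, Finset.sum_apply, Pi.single_apply,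
    QBasis.work_injective.eq_iff, hι.eq_iff]

lemma QState.embed_of_notMem {ι : Y → Fin w → Bool} (ψ : Y → ℂ) {i : QBasis n w}
    (hi : ∀ y, QBasis.work (ι y) ≠ i) : (QState.embed ι ψ : QState n w) i = 0 := by
  simp only [QState.embed, Finset.sum_apply]
  refine Finset.sum_eq_zero fun y _ => ?_
  simp [(hi y).symm]

lemma QState.sum_embed {M : Type*} [AddCommMonoid M] {ι : Y → Fin w → Bool}
    (hι : Function.Injective ι) (g : QBasis n w → M)
    (hg : ∀ i, (∀ y, QBasis.work (ι y) ≠ i) → g i = 0) :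
    ∑ i, g i = ∑ y, g (QBasis.work (ι y)) := by
  have hinj : Function.Injective fun y => QBasis.work (n := n) (ι y) :=
    QBasis.work_injective.comp hι
  rw [← Finset.sum_image (f := g) (s := Finset.univ) hinj.injOn]
  refine (Finset.sum_subset (Finset.subset_univ _) fun i _ hi => hg i fun y hy => ?_).symm
  exact hi (Finset.mem_image.2 ⟨y, Finset.mem_univ _, hy⟩)

/-- The columns of `U`, embedded in the larger space, are still orthonormal, so they extend to a
unitary there. -/
lemma QueryCircuit.exists_gate {ι : Y → Fin w → Bool} (hι : Function.Injective ι)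
    {U : Matrix Y Y ℂ} (hU : U ∈ unitaryGroup Y ℂ) :
    ∃ V : unitaryGroup (QBasis n w) ℂ, ∀ ψ : Y → ℂ,
      V.1 *ᵥ (QState.embed ι ψ : QState n w) = QState.embed ι (U *ᵥ ψ) := by
  obtain ⟨V, hV, h⟩ := exists_unitary_extends (fun y => QBasis.work (n := n) (ι y))
    (QBasis.work_injective.comp hι) (fun y => QState.embed ι fun y' => U y' y) (fun z z' => by
      rw [QState.sum_embed hι _ fun i hi => by simp [QState.embed_of_notMem _ hi]]
      simp only [QState.embed_work hι]
      have := congrFun (congrFun (mem_unitaryGroup_iff'.1 hU) z) z'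
      simpa [Matrix.mul_apply, star_apply, one_apply] using this)
  refine ⟨⟨V, hV⟩, fun ψ => ?_⟩
  rw [QState.embed, mulVec_sum_smul]
  have h' : ∀ y, V *ᵥ Pi.single (QBasis.work (n := n) (ι y)) 1
      = QState.embed ι fun y' => U y' y := fun y => by
    ext i
    simp [h]
  simp only [h', QState.embed, Finset.smul_sum, smul_smul]
  rw [Finset.sum_comm]
  refine Finset.sum_congr rfl fun y _ => ?_
  rw [← Finset.sum_smul]
  simp [mulVec, dotProduct, mul_comm]

/-- An eigenvector of the oracle with eigenvalue `(-1) ^ (c && f x)`. -/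
noncomputable def QState.kickback (x : Fin n → Bool) (c : Bool) (z : Fin w → Bool) : QState n w :=
  fun i => if i.1 = x ∧ i.2.2 = z then (if c && i.2.1 then -1 else 1) * ((√2)⁻¹ : ℝ) else 0

lemma QState.oracle_kickback (f : (Fin n → Bool) → Bool) (x : Fin n → Bool) (c : Bool)
    (z : Fin w → Bool) :
    QState.oracle f (QState.kickback x c z) =
      (if c && f x then -1 else 1 : ℂ) • QState.kickback x c z := by
  ext ⟨x', b, z'⟩
  simp only [QState.oracle, QState.kickback, Pi.smul_apply, smul_eq_mul]
  by_cases h : x' = x ∧ z' = z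
  · obtain ⟨rfl, rfl⟩ := h
    cases c <;> cases b <;> cases f x' <;> simp
  · simp [h]

/-- The work register alone separates different `y`; hence the queried point `x y` and the control
`c y` may be arbitrary functions of `y`. -/
lemma QState.kickback_orthonormal {ι : Y → Fin w → Bool} (hι : Function.Injective ι)
    (x : Y → Fin n → Bool) (c : Y → Bool) (y y' : Y) :
    ∑ i, star (QState.kickback (x y) (c y) (ι y) i) * QState.kickback (x y') (c y') (ι y') i =
      if y = y' then 1 else 0 := by
  by_cases h : y = y'
  · subst h
    rw [if_pos rfl, Fintype.sum_prod_type, Finset.sum_eq_single (x y)]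
    · have h2 : ((√2 : ℝ) : ℂ)⁻¹ * ((√2 : ℝ) : ℂ)⁻¹ = 1 / 2 := by
        rw [← mul_inv, ← Complex.ofReal_mul, Real.mul_self_sqrt (by norm_num)]
        norm_num
      rw [Fintype.sum_prod_type]
      simp only [QState.kickback, true_and]
      cases c y <;> norm_num [h2]
    · intro x' _ hx'
      refine Finset.sum_eq_zero fun _ _ => ?_
      simp [QState.kickback, hx']
    · simp
  · rw [if_neg h]
    refine Finset.sum_eq_zero fun i _ => ?_
    simp only [QState.kickback]
    by_cases h1 : i.2.2 = ι y
    · have : i.2.2 ≠ ι y' := fun h2 => h (hι (h1.symm.trans h2))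
      simp [this]
    · simp [h1]

lemma QState.oracle_sum_smul (f : (Fin n → Bool) → Bool) (ψ : Y → ℂ) (v : Y → QState n w) :
    QState.oracle f (∑ y, ψ y • v y) = ∑ y, ψ y • QState.oracle f (v y) := by
  ext i
  simp [QState.oracle, Finset.sum_apply]

/-- Every query circuit can be run by a query algorithm. -/
lemma QueryCircuit.simulate {A : Type} {q : ℕ} {S : A → ((Fin n → Bool) → Bool) → Matrix Y Y ℂ}
    (h : QueryCircuit n A Y q S) (a : A) {ι : Y → Fin w → Bool} (hι : Function.Injective ι) :
    ∃ T : QueryAlgorithm n w → QueryAlgorithm n w, ∀ next f E (ψ : Y → ℂ) q₀,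
      (T next).probFrom f E (QState.embed ι ψ) q₀ =
        next.probFrom f E (QState.embed ι (S a f *ᵥ ψ)) (q₀ + q) := by
  induction h with
  | gate U hU =>
    obtain ⟨V, hV⟩ := exists_gate (n := n) hι (hU a)
    exact ⟨.gate V, fun next f E ψ q₀ => by simp [QueryAlgorithm.probFrom, hV]⟩
  | query x c =>
    obtain ⟨V, hV, h⟩ := exists_unitary_extends (fun y => QBasis.work (n := n) (ι y))
      (QBasis.work_injective.comp hι) (fun y => QState.kickback (x a y) (c a y) (ι y))
      (QState.kickback_orthonormal hι _ _)
    have h1 : ∀ y, V *ᵥ Pi.single (QBasis.work (n := n) (ι y)) 1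
        = QState.kickback (x a y) (c a y) (ι y) := fun y => by
      ext i
      simp [h]
    have h2 : ∀ y, Star.star V *ᵥ QState.kickback (x a y) (c a y) (ι y) =
        Pi.single (QBasis.work (n := n) (ι y)) 1 := fun y => by
      rw [← h1, mulVec_mulVec, mem_unitaryGroup_iff'.1 hV, one_mulVec]
    -- Phase kickback: `V` writes the query point and puts the target into `|±⟩`, the oracle
    -- contributes a sign, and `star V` uncomputes. When the control is off the target is `|+⟩`,
    -- which the oracle fixes.
    refine ⟨fun next => .gate ⟨V, hV⟩ (.query (.gate ⟨Star.star V, Unitary.star_mem hV⟩ next)),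
      fun next f E ψ q₀ => ?_⟩
    simp only [QueryAlgorithm.probFrom]
    congr 1
    simp only [QState.embed, mulVec_sum_smul, h1, QState.oracle_sum_smul, QState.oracle_kickback,
      h2, phaseMatrix, mulVec_diagonal, smul_smul]
    refine Finset.sum_congr rfl fun y _ => ?_
    rw [mul_comm]
  | mul _ _ ih1 ih2 =>
    obtain ⟨T₁, h1⟩ := ih1
    obtain ⟨T₂, h2⟩ := ih2
    refine ⟨fun next => T₂ (T₁ next), fun next f E ψ q₀ => ?_⟩
    rw [h2, h1, mulVec_mulVec, add_assoc, add_comm q₀]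
    congr 1
    ring

lemma QueryAlgorithm.exists_reset (i i' : QBasis n w) : ∃ V : unitaryGroup (QBasis n w) ℂ,
    (V : Matrix _ _ ℂ) *ᵥ Pi.single i 1 = Pi.single i' 1 := by
  obtain ⟨V, hV, h⟩ := exists_unitary_col i (Pi.single i' (1 : ℂ))
    (by simp [Pi.single_apply, apply_ite])
  exact ⟨⟨V, hV⟩, by ext j; simp [h]⟩

/-- After a measurement of all qubits the algorithm may continue from the all-zero state. -/
lemma QueryAlgorithm.exists_measure_all (cont : QBasis n w → QueryAlgorithm n w) :
    ∃ A : QueryAlgorithm n w, ∀ f E φ q, A.probFrom f E φ q =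
      ∑ i, ‖φ i‖ ^ 2 * (cont i).probFrom f E (QState.init n w) q := by
  choose V hV using fun i : QBasis n w =>
    exists_reset i ((fun _ => false, false, fun _ => false) : QBasis n w)
  let e := Fintype.equivFin (QBasis n w)
  refine ⟨.measure _ e fun k => .gate (V (e.symm k)) (cont (e.symm k)), fun f E φ q => ?_⟩
  simp only [probFrom]
  rw [← e.sum_comp]
  refine Finset.sum_congr rfl fun i _ => ?_
  have : QState.project e (e i) φ = φ i • Pi.single i 1 := by
    ext i'
    by_cases h : i' = i
    · subst h; simp [QState.project]
    · simp [QState.project, h]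
  rw [this, e.symm_apply_apply, mulVec_smul, hV, probFrom_smul]
  rfl

/-- A query circuit, followed by a measurement of a flag, on which the algorithm branches. -/
lemma QueryCircuit.exists_branch {A : Type} {q : ℕ}
    {S : A → ((Fin n → Bool) → Bool) → Matrix Y Y ℂ}
    (h : QueryCircuit n A Y q S) (a : A) (z : Y) (flag : Y → Prop) [DecidablePred flag]
    (hw : Fintype.card Y ≤ w) (yes no : QueryAlgorithm n w) :
    ∃ B : QueryAlgorithm n w, ∀ f E q₀, B.probFrom f E (QState.init n w) q₀ =
      (∑ y with flag y, ‖S a f y z‖ ^ 2) * yes.probFrom f E (QState.init n w) (q₀ + q) +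
      (1 - ∑ y with flag y, ‖S a f y z‖ ^ 2) * no.probFrom f E (QState.init n w) (q₀ + q) := by
  obtain ⟨ι⟩ : Nonempty (Y ↪ (Fin w → Bool)) := Function.Embedding.nonempty_of_card_le (by
    simpa using (hw.trans Nat.lt_two_pow_self.le))
  have hinj : Function.Injective fun y => QBasis.work (n := n) (ι y) :=
    QBasis.work_injective.comp ι.injective
  obtain ⟨T, hT⟩ := h.simulate (w := w) a ι.injective
  obtain ⟨V, hV⟩ := QueryAlgorithm.exists_reset
    ((fun _ => false, false, fun _ => false) : QBasis n w) (QBasis.work (ι z))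
  obtain ⟨M, hM⟩ := QueryAlgorithm.exists_measure_all
    (Function.extend (fun y => QBasis.work (n := n) (ι y)) (fun y => if flag y then yes else no)
      fun _ => no)
  refine ⟨.gate V (T M), fun f E q₀ => ?_⟩
  have h0 : V.1 *ᵥ QState.init n w = QState.embed ι (Pi.single z 1) := by
    rw [QState.init, hV, QState.embed, Finset.sum_eq_single z] <;> simp +contextual
  rw [QueryAlgorithm.probFrom, h0, hT, hM,
    QState.sum_embed ι.injective _ fun i hi => by simp [QState.embed_of_notMem _ hi]]
  have h1 := Finset.sum_filter_add_sum_filter_not Finset.univ flag fun y => ‖S a f y z‖ ^ 2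
  rw [sum_norm_sq_col (h.mem_unitary a f)] at h1
  rw [← eq_sub_iff_add_eq'] at h1
  rw [← h1, Finset.sum_mul, Finset.sum_mul, ← Finset.sum_filter_add_sum_filter_not _ flag]
  congr 1 <;> refine Finset.sum_congr rfl fun y hy => ?_
  all_goals
    rw [QState.embed_work ι.injective, hinj.extend_apply]
    simp [(Finset.mem_filter.1 hy).2]

end Realization

/-! ### Majority votes of independent trials -/

section Vote

variable {ι Y : Type} [Fintype ι] [DecidableEq ι] [Fintype Y] [DecidableEq Y]

/-- At least one eighth of the entries of `y` are flagged. -/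
abbrev Vote (flag : Y → Prop) [DecidablePred flag] (y : ι → Y) : Prop :=
  Fintype.card ι ≤ 8 * (Finset.univ.filter fun i => flag (y i)).card

/-- Chernoff's method: the indicator of `P` is bounded by a product of factors, whose expectation is
a power by independence. -/
lemma sum_filter_prod_le (μ g : Y → ℝ) (hμ : ∀ y, 0 ≤ μ y) (hg : ∀ y, 0 ≤ g y)
    (P : (ι → Y) → Prop) [DecidablePred P] (hP : ∀ y, P y → 1 ≤ ∏ i, g (y i)) :
    ∑ y : ι → Y with P y, ∏ i, μ (y i) ≤ (∑ y, μ y * g y) ^ Fintype.card ι := by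
  calc ∑ y : ι → Y with P y, ∏ i, μ (y i)
      ≤ ∑ y : ι → Y with P y, ∏ i, (μ (y i) * g (y i)) := by
        refine Finset.sum_le_sum fun y hy => ?_
        rw [Finset.prod_mul_distrib]
        exact le_mul_of_one_le_right (Finset.prod_nonneg fun i _ => hμ _)
          (hP y (Finset.mem_filter.1 hy).2)
    _ ≤ ∑ y : ι → Y, ∏ i, (μ (y i) * g (y i)) :=
        Finset.sum_le_sum_of_subset_of_nonneg (Finset.filter_subset _ _) fun y _ _ =>
          Finset.prod_nonneg fun i _ => mul_nonneg (hμ _) (hg _)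
    _ = (∑ y, μ y * g y) ^ Fintype.card ι := by
        have := Finset.prod_univ_sum (fun _ : ι => (Finset.univ : Finset Y))
          fun _ y => μ y * g y
        simp only [Finset.prod_const, Finset.card_univ, Fintype.piFinset_univ] at this
        rw [this]

variable (flag : Y → Prop) [DecidablePred flag] (μ : Y → ℝ)

lemma sum_mul_ite (h1 : ∑ y, μ y = 1) (a b : ℝ) :
    ∑ y, μ y * (if flag y then a else b) =
      b + (a - b) * ∑ y with flag y, μ y := by
  have h2 := Finset.sum_filter_add_sum_filter_not Finset.univ flag μ
  simp only [mul_ite, Finset.sum_ite, ← Finset.sum_mul]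
  rw [h1, ← eq_sub_iff_add_eq'] at h2
  rw [h2]
  ring

lemma card_filter_flag (y : ι → Y) :
    (Finset.univ.filter fun i => flag (y i)).card +
      (Finset.univ.filter fun i => ¬ flag (y i)).card = Fintype.card ι := by
  rw [Finset.card_filter_add_card_filter_not, Finset.card_univ]

lemma sum_vote_le (hμ : ∀ y, 0 ≤ μ y) (h1 : ∑ y, μ y = 1)
    (hp : ∑ y with flag y, μ y ≤ 1 / 1024) :
    ∑ y : ι → Y with Vote flag y, ∏ i, μ (y i) ≤ (97 / 100) ^ Fintype.card ι := by
  -- With `c` flags among `N` entries the product is `2 ^ (7c - (N - c))`, at least `1` exactly when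
  -- `8c ≥ N`. Its mean per entry is at most `1/2 + 127.5/1024`.
  refine (sum_filter_prod_le μ (fun y => if flag y then 2 ^ 7 else 1 / 2) hμ
    (fun y => by split_ifs <;> norm_num) _ fun y hy => ?_).trans ?_
  · have hc := card_filter_flag flag y
    simp only [Vote] at hy
    rw [Finset.prod_ite, Finset.prod_const, Finset.prod_const, ← pow_mul, one_div, inv_pow,
      ← div_eq_mul_inv, one_le_div (by positivity)]
    exact pow_le_pow_right₀ (by norm_num) (by omega)
  · rw [sum_mul_ite flag μ h1]
    have h0 : 0 ≤ ∑ y with flag y, μ y := Finset.sum_nonneg fun y _ => hμ y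
    refine pow_le_pow_left₀ (by linarith) (by linarith) _

lemma sum_not_vote_le (hμ : ∀ y, 0 ≤ μ y) (h1 : ∑ y, μ y = 1)
    (hp : 1 / 4 ≤ ∑ y with flag y, μ y) :
    ∑ y : ι → Y with ¬ Vote flag y, ∏ i, μ (y i) ≤ (97 / 100) ^ Fintype.card ι := by
  -- The ratio of exponents again encodes the threshold `1/8`; base `6/5` makes the mean at flag
  -- probability `1/4` just below `97/100`.
  refine (sum_filter_prod_le μ (fun y => if flag y then ((6 / 5) ^ 7)⁻¹ else 6 / 5) hμ
    (fun y => by split_ifs <;> norm_num) _ fun y hy => ?_).trans ?_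
  · have hc := card_filter_flag flag y
    simp only [Vote] at hy
    rw [Finset.prod_ite, Finset.prod_const, Finset.prod_const, inv_pow, ← pow_mul, mul_comm,
      ← div_eq_mul_inv, one_le_div (by positivity)]
    exact pow_le_pow_right₀ (by norm_num) (by omega)
  · rw [sum_mul_ite flag μ h1]
    have h2 : ∑ y with flag y, μ y ≤ 1 :=
      h1 ▸ Finset.sum_le_sum_of_subset_of_nonneg (Finset.filter_subset _ _) fun y _ _ => hμ y
    refine pow_le_pow_left₀ ?_ ?_ _
    · norm_num at h2 ⊢; linarith
    · norm_num at hp ⊢; linarith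

lemma sum_prod_eq_one (h1 : ∑ y, μ y = 1) : ∑ y : ι → Y, ∏ i, μ (y i) = 1 := by
  have := Finset.prod_univ_sum (fun _ : ι => (Finset.univ : Finset Y)) fun _ y => μ y
  simp only [Finset.prod_const, Finset.card_univ, Fintype.piFinset_univ, h1, one_pow] at this
  exact this.symm

lemma one_sub_le_sum_vote (hμ : ∀ y, 0 ≤ μ y) (h1 : ∑ y, μ y = 1)
    (hp : 1 / 4 ≤ ∑ y with flag y, μ y) :
    1 - (97 / 100) ^ Fintype.card ι ≤ ∑ y : ι → Y with Vote flag y, ∏ i, μ (y i) := by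
  have h2 := Finset.sum_filter_add_sum_filter_not Finset.univ (fun y : ι → Y => Vote flag y)
    fun y => ∏ i, μ (y i)
  rw [sum_prod_eq_one μ h1] at h2
  linarith [sum_not_vote_le (ι := ι) flag μ hμ h1 hp]

end Vote

/-! ### The Fejér kernel -/

/-- The Fejér kernel, normalized to have the value `1` at `0`. -/
noncomputable def fejer (K : ℕ) (y : ℝ) : ℝ :=
  ‖∑ k : Fin K, Complex.exp (Complex.I * y) ^ (k : ℕ)‖ ^ 2 / K ^ 2

lemma fejer_nonneg (K : ℕ) (y : ℝ) : 0 ≤ fejer K y := by unfold fejer; positivity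

/-- The sum is geometric, `(w ^ K - 1) / (w - 1)`, with numerator at most `2` and denominator `2
|sin (y / 2)|` in norm. -/
lemma fejer_le {K : ℕ} (hK : 0 < K) {y s : ℝ} (hs : 0 < s) (h : s ≤ |Real.sin (y / 2)|) :
    fejer K y ≤ 1 / (K * s) ^ 2 := by
  set w := Complex.exp (Complex.I * y) with hw
  have hw1 : ‖w‖ = 1 := by rw [hw, mul_comm, Complex.norm_exp_ofReal_mul_I]
  have h1 : (∑ k : Fin K, w ^ (k : ℕ)) * (w - 1) = w ^ K - 1 := by
    rw [Fin.sum_univ_eq_sum_range (fun k => w ^ k), geom_sum_mul]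
  have h2 : ‖w - 1‖ = 2 * |Real.sin (y / 2)| := by
    rw [hw, Complex.norm_exp_I_mul_ofReal_sub_one, Real.norm_eq_abs, abs_mul]
    norm_num
  have h3 : ‖w ^ K - 1‖ ≤ 2 := by
    refine (norm_sub_le _ _).trans ?_
    rw [norm_pow, hw1]
    norm_num
  rw [← h1, norm_mul, h2] at h3
  have h4 : ‖∑ k : Fin K, w ^ (k : ℕ)‖ * s ≤ 1 := by
    have := mul_le_mul_of_nonneg_left h (norm_nonneg (∑ k : Fin K, w ^ (k : ℕ)))
    linarith
  have hK' : (0 : ℝ) < K := by exact_mod_cast hK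
  unfold fejer
  rw [div_le_div_iff₀ (by positivity) (by positivity), mul_pow]
  have := pow_le_one₀ (n := 2) (by positivity) h4
  rw [mul_pow] at this
  nlinarith [sq_nonneg (K : ℝ)]

lemma half_le_fejer {K : ℕ} (hK : 0 < K) {y : ℝ} (h : K * |y| ≤ 1 / 2) : 1 / 2 ≤ fejer K y := by
  have hK' : (0 : ℝ) < K := by exact_mod_cast hK
  -- All phases lie within `1/2` of zero, where the cosine is at least `1 - 1/8`, so no cancellation
  -- occurs.
  have h1 : (7 / 8 : ℝ) * K ≤ ‖∑ k : Fin K, Complex.exp (Complex.I * y) ^ (k : ℕ)‖ := by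
    refine le_trans ?_ (Complex.re_le_norm _)
    rw [Complex.re_sum]
    have : ∀ k : Fin K, (7 / 8 : ℝ) ≤ (Complex.exp (Complex.I * y) ^ (k : ℕ)).re := by
      intro k
      have e : Complex.exp (Complex.I * y) ^ (k : ℕ) = Complex.exp ((k * y : ℝ) * Complex.I) := by
        rw [← Complex.exp_nat_mul]
        push_cast
        ring_nf
      rw [e, Complex.exp_ofReal_mul_I_re]
      have h2 : |(k : ℝ) * y| ≤ 1 / 2 := by
        rw [abs_mul, Nat.abs_cast]
        refine le_trans ?_ h
        gcongr
        exact k.2.le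
      have h3 := Real.one_sub_sq_div_two_le_cos (x := k * y)
      have h4 := sq_le_sq' (neg_le_of_abs_le h2) (le_of_abs_le h2)
      linarith
    calc (7 / 8 : ℝ) * K = ∑ _k : Fin K, (7 / 8 : ℝ) := by simp; ring
      _ ≤ _ := Finset.sum_le_sum fun k _ => this k
  unfold fejer
  rw [div_le_div_iff₀ (by norm_num) (by positivity)]
  nlinarith [mul_self_le_mul_self (by positivity) h1]

/-! ### Quantum walks whose return amplitudes are cosines -/

section Walk

variable {Y : Type} [Fintype Y] [DecidableEq Y] {G : Matrix Y Y ℂ} {z : Y} {η : ℝ}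

/-- Since `G + star G` scales the basis vector by `2 cos η`, the diagonal entries of the powers obey
the Chebyshev recurrence. -/
lemma pow_apply_eq_cos (hG : G ∈ unitaryGroup Y ℂ) (h0 : G z z = Real.cos η)
    (h : G *ᵥ Pi.single z 1 + star G *ᵥ Pi.single z 1 = (2 * Real.cos η : ℂ) • Pi.single z 1)
    (m : ℕ) : (G ^ m) z z = Real.cos (m * η) := by
  induction m using Nat.twoStepInduction with
  | zero => simp
  | one => simpa using h0
  | more m ih1 ih2 =>
    have h1 : G ^ (m + 1) *ᵥ (G *ᵥ Pi.single z 1 + star G *ᵥ Pi.single z 1) =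
        G ^ (m + 2) *ᵥ Pi.single z 1 + G ^ m *ᵥ Pi.single z 1 := by
      rw [mulVec_add, mulVec_mulVec, mulVec_mulVec, ← pow_succ, pow_succ G m, mul_assoc,
        mem_unitaryGroup_iff.1 hG, mul_one]
    rw [h, mulVec_smul] at h1
    have h2 := congrFun h1 z
    simp only [Pi.smul_apply, Pi.add_apply, mulVec_single_one, col_apply, smul_eq_mul, ih1,
      ih2] at h2
    rw [← sub_eq_iff_eq_add] at h2
    rw [← h2]
    norm_cast
    push_cast
    rw [show ((m : ℝ) + 2) * η = (m + 1) * η + η by ring,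
      show (m : ℝ) * η = (m + 1) * η - η by ring, Real.cos_add, Real.cos_sub]
    ring

lemma star_pow_mul_pow_apply (hG : G ∈ unitaryGroup Y ℂ)
    (h : ∀ m : ℕ, (G ^ m) z z = Real.cos (m * η)) (j k : ℕ) :
    (star (G ^ j) * G ^ k) z z = Real.cos (((k : ℝ) - j) * η) := by
  have hu : ∀ m, star (G ^ m) * G ^ m = 1 := fun m => mem_unitaryGroup_iff'.1 (pow_mem hG m)
  rcases le_total j k with hjk | hjk
  · obtain ⟨d, rfl⟩ := Nat.exists_eq_add_of_le hjk
    rw [pow_add, ← mul_assoc, hu, one_mul, h]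
    congr 2
    push_cast
    ring
  · obtain ⟨d, rfl⟩ := Nat.exists_eq_add_of_le hjk
    rw [pow_add, star_mul, mul_assoc, hu, mul_one, star_apply, h]
    simp only [Complex.star_def, Complex.conj_ofReal]
    rw [← Real.cos_neg]
    congr 2
    push_cast
    ring

/-- The weight of a superposition of the states of a walk. -/
lemma sum_norm_sq_walk (hG : G ∈ unitaryGroup Y ℂ)
    (h : ∀ m : ℕ, (G ^ m) z z = Real.cos (m * η)) (K : ℕ) (φ : ℝ) :
    ∑ y, ‖∑ k : Fin K, Complex.exp (-(Complex.I * φ)) ^ (k : ℕ) / K * (G ^ (k : ℕ)) y z‖ ^ 2 =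
      (fejer K (η - φ) + fejer K (-(η + φ))) / 2 := by
  set w := fun k : Fin K => Complex.exp (-(Complex.I * φ)) ^ (k : ℕ) / K with hw
  -- The walk states have Gram matrix `cos ((k - j) η)`; splitting the cosine into exponentials
  -- yields the two Fejér kernels.
  have hL : ((∑ y, ‖∑ k, w k * (G ^ (k : ℕ)) y z‖ ^ 2 : ℝ) : ℂ) =
      ∑ j, ∑ k, star (w j) * w k * Real.cos (((k : ℕ) - (j : ℕ) : ℝ) * η) := by
    push_cast
    simp only [← Complex.conj_mul', map_sum, map_mul, Finset.sum_mul_sum]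
    rw [Finset.sum_comm]
    refine Finset.sum_congr rfl fun j _ => ?_
    rw [Finset.sum_comm]
    refine Finset.sum_congr rfl fun k _ => ?_
    have hc := star_pow_mul_pow_apply hG h j k
    push_cast at hc
    rw [← hc, Matrix.mul_apply, Finset.mul_sum]
    refine Finset.sum_congr rfl fun y _ => ?_
    rw [star_apply]
    simp only [Complex.star_def]
    ring
  have hF : ∀ y : ℝ, (fejer K y : ℂ) = ∑ j : Fin K, ∑ k : Fin K,
      Complex.exp (Complex.I * (((k : ℕ) - (j : ℕ)) * y)) / K ^ 2 := by
    intro y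
    simp only [fejer, Complex.ofReal_div, Complex.ofReal_pow, ← Complex.conj_mul', map_sum,
      Finset.sum_mul_sum, Finset.sum_div]
    push_cast
    refine Finset.sum_congr rfl fun j _ => Finset.sum_congr rfl fun k _ => ?_
    congr 1
    rw [map_pow, ← Complex.exp_conj, ← Complex.exp_nat_mul, ← Complex.exp_nat_mul, ← Complex.exp_add]
    simp only [map_mul, Complex.conj_I, Complex.conj_ofReal]
    congr 1
    ring
  apply Complex.ofReal_injective
  rw [hL]
  push_cast
  simp only [hF, ← Finset.sum_add_distrib, Finset.sum_div]
  refine Finset.sum_congr rfl fun j _ => Finset.sum_congr rfl fun k _ => ?_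
  simp only [hw, Complex.star_def, map_div₀, ← Complex.exp_conj, map_neg, map_mul,
    Complex.conj_I, Complex.conj_ofReal, map_natCast, ← Complex.exp_nat_mul, Complex.cos]
  rw [div_mul_div_comm, ← Complex.exp_add, ← add_div, div_mul_div_comm, div_div, mul_add,
    ← Complex.exp_add, ← Complex.exp_add]
  congr 1
  · congr 2 <;> (push_cast; ring)
  · ring

end Walk

/-! ### The walk generated by two reflections -/

section Reflection

variable {Y : Type} [Fintype Y] [DecidableEq Y]

/-- The reflection about a basis vector. -/
def basisReflection (z : Y) : Matrix Y Y ℂ := diagonal fun y => if y = z then 1 else -1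

lemma basisReflection_mem_unitary (z : Y) : basisReflection z ∈ unitaryGroup Y ℂ :=
  diagonal_mem_unitary fun y => by split_ifs <;> simp

lemma star_basisReflection (z : Y) : star (basisReflection z) = basisReflection z := by
  rw [basisReflection, star_eq_conjTranspose, diagonal_conjTranspose]
  congr 1
  ext y
  simp only [Pi.star_apply]
  split_ifs <;> simp

lemma basisReflection_mulVec (z : Y) (v : Y → ℂ) :
    basisReflection z *ᵥ v = (2 * v z) • Pi.single z 1 - v := by
  ext y
  by_cases h : y = z
  · subst h
    simp [basisReflection, mulVec_diagonal]
    ring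
  · simp [basisReflection, mulVec_diagonal, h]

/-- The product of two reflections, squared, up to a sign. -/
def walkMatrix (z : Y) (V : Matrix Y Y ℂ) : Matrix Y Y ℂ :=
  -(basisReflection z * V * (basisReflection z * V))

variable {z : Y} {V : Matrix Y Y ℂ}

lemma walkMatrix_mem_unitary (hV : V ∈ unitaryGroup Y ℂ) :
    walkMatrix z V ∈ unitaryGroup Y ℂ := by
  have h := mul_mem (basisReflection_mem_unitary z) hV
  have h2 := mul_mem h h
  rw [mem_unitaryGroup_iff] at h2 ⊢
  rw [walkMatrix, star_neg, neg_mul_neg]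
  exact h2

/-- On the span of `e` and `V e` the product of the two reflections rotates by an angle with cosine
`x`. Squaring and negating turns this cosine into `1 - 2 x ^ 2 = cos (2 ψ)`, which does not depend
on the sign of `x`. -/
lemma walkMatrix_pow_apply (hV : V ∈ unitaryGroup Y ℂ) (hs : star V = V) {x ψ : ℝ}
    (hx : V z z = x) (hψ : x ^ 2 = Real.sin ψ ^ 2) (m : ℕ) :
    (walkMatrix z V ^ m) z z = Real.cos (m * (2 * ψ)) := by
  have hcos : (Real.cos (2 * ψ) : ℂ) = 1 - 2 * x ^ 2 := by
    rw [Real.cos_two_mul, Real.cos_sq', ← hψ]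
    push_cast
    ring
  set e : Y → ℂ := Pi.single z 1 with he
  have hez : e z = 1 := by simp [e]
  have hVV : V *ᵥ (V *ᵥ e) = e := by
    have := mem_unitaryGroup_iff.1 hV
    rw [hs] at this
    rw [mulVec_mulVec, this, one_mulVec]
  have hVz : (V *ᵥ e) z = x := by simp [e, hx]
  have hRe : basisReflection z *ᵥ e = e := by
    rw [basisReflection_mulVec, hez, ← he]
    module
  have h1 : V *ᵥ (basisReflection z *ᵥ (V *ᵥ e)) = (2 * x : ℂ) • (V *ᵥ e) - e := by
    rw [basisReflection_mulVec, hVz, ← he, mulVec_sub, mulVec_smul, hVV]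
  have h2 : walkMatrix z V *ᵥ e = (2 * x : ℂ) • (V *ᵥ e) - (4 * x ^ 2 - 1 : ℂ) • e := by
    rw [walkMatrix, neg_mulVec, ← mulVec_mulVec, ← mulVec_mulVec, ← mulVec_mulVec, h1,
      basisReflection_mulVec, ← he]
    simp only [Pi.sub_apply, Pi.smul_apply, hVz, hez, smul_eq_mul]
    module
  have h3 : star (walkMatrix z V) *ᵥ e = e - (2 * x : ℂ) • (V *ᵥ e) := by
    rw [walkMatrix, star_neg, star_mul, star_mul, hs, star_basisReflection, neg_mulVec,
      ← mulVec_mulVec, ← mulVec_mulVec, ← mulVec_mulVec, hRe, h1]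
    module
  refine pow_apply_eq_cos (walkMatrix_mem_unitary hV) ?_ ?_ m
  · have := congrFun h2 z
    simp only [he, mulVec_single_one, col_apply, Pi.sub_apply, Pi.smul_apply, hx,
      Pi.single_eq_same, smul_eq_mul] at this
    rw [this, hcos]
    ring
  · rw [← he, h2, h3, hcos]
    module

end Reflection

/-! ### The Walsh-Hadamard transform -/

section Walsh

variable {n : ℕ}

/-- The character `y ↦ (-1) ^ (a · y)`. -/
def walshSign (a y : Fin n → Bool) : ℂ := ∏ i, if a i && y i then -1 else 1

lemma norm_walshSign (a y : Fin n → Bool) : ‖walshSign a y‖ = 1 := by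
  rw [walshSign, norm_prod]
  refine Finset.prod_eq_one fun i _ => ?_
  split_ifs <;> simp

/-- The matrix of the Hadamard transform on `n` qubits. -/
noncomputable def walshHadamard (n : ℕ) : Matrix (Fin n → Bool) (Fin n → Bool) ℂ :=
  piKron fun _ => Matrix.of fun x y => (if x && y then -1 else 1) * ((√2)⁻¹ : ℝ)

lemma walshHadamard_apply (a y : Fin n → Bool) :
    walshHadamard n a y = walshSign a y * ((√2)⁻¹ ^ n : ℝ) := by
  simp only [walshHadamard, piKron, walshSign, of_apply, Finset.prod_mul_distrib]
  simp

lemma walshHadamard_zero_left (y : Fin n → Bool) :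
    walshHadamard n (fun _ => false) y = ((√2)⁻¹ ^ n : ℝ) := by
  simp [walshHadamard_apply, walshSign]

lemma walshHadamard_zero_right (y : Fin n → Bool) :
    walshHadamard n y (fun _ => false) = ((√2)⁻¹ ^ n : ℝ) := by
  simp [walshHadamard_apply, walshSign]

lemma star_walshHadamard : star (walshHadamard n) = walshHadamard n := by
  rw [walshHadamard, star_piKron]
  congr 1
  ext i x y
  rw [star_apply]
  cases x <;> cases y <;> simp

lemma walshHadamard_mem_unitary (n : ℕ) : walshHadamard n ∈ unitaryGroup (Fin n → Bool) ℂ := by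
  refine piKron_mem_unitary fun _ => ?_
  have h2 : ((√2 : ℝ) : ℂ)⁻¹ * ((√2 : ℝ) : ℂ)⁻¹ = 1 / 2 := by
    rw [← mul_inv, ← Complex.ofReal_mul, Real.mul_self_sqrt (by norm_num)]
    norm_num
  rw [mem_unitaryGroup_iff]
  ext x y
  cases x <;> cases y <;> norm_num [Matrix.mul_apply, star_apply, h2]

lemma walshHadamard_mul_self : walshHadamard n * walshHadamard n = 1 := by
  have h := mem_unitaryGroup_iff.1 (walshHadamard_mem_unitary n)
  rwa [star_walshHadamard] at h

lemma neg_one_pow_eq_walshSign (f : (Fin n → Bool) → Bool) (a x : Fin n → Bool) :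
    (-1 : ℂ) ^ ((f x).toNat + ∑ i, (a i && x i).toNat) =
      (if f x then -1 else 1) * walshSign a x := by
  rw [pow_add, ← Finset.prod_pow_eq_pow_sum, walshSign]
  congr 1
  · cases f x <;> simp
  · refine Finset.prod_congr rfl fun i _ => ?_
    cases a i && x i <;> simp

lemma walshCoeff_eq_sum (f : (Fin n → Bool) → Bool) (a : Fin n → Bool) :
    (walshCoeff f a : ℂ) = ∑ x, (((√2)⁻¹ ^ n : ℝ) : ℂ) * ((if f x then -1 else 1) * walshSign a x)
      * ((√2)⁻¹ ^ n : ℝ) := by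
  rw [← Finset.sum_mul, ← Finset.mul_sum, mul_right_comm, ← Complex.ofReal_mul, ← mul_pow,
    ← mul_inv, Real.mul_self_sqrt (by norm_num), walshCoeff]
  push_cast
  simp only [neg_one_pow_eq_walshSign]
  rw [inv_pow, div_eq_inv_mul]

/-- The unitary that prepares the state with amplitudes `walshCoeff f a`. -/
noncomputable def samplingMatrix (f : (Fin n → Bool) → Bool) :
    Matrix (Fin n → Bool) (Fin n → Bool) ℂ :=
  walshHadamard n * (phaseMatrix id (fun _ => true) f * walshHadamard n)

lemma samplingMatrix_apply_zero (f : (Fin n → Bool) → Bool) (a : Fin n → Bool) :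
    samplingMatrix f a (fun _ => false) = walshCoeff f a := by
  rw [samplingMatrix, Matrix.mul_apply, walshCoeff_eq_sum]
  refine Finset.sum_congr rfl fun x _ => ?_
  rw [phaseMatrix, diagonal_mul, walshHadamard_zero_right, walshHadamard_apply]
  simp only [Bool.true_and, id]
  ring

lemma samplingMatrix_circuit (A : Type) : QueryCircuit n A (Fin n → Bool) 1
    fun _ f => samplingMatrix f := by
  have hH := QueryCircuit.gate (n := n) (fun _ : A => walshHadamard n) fun _ => walshHadamard_mem_unitary n
  exact hH.mul ((QueryCircuit.query (fun _ => id) fun _ _ => true).mul hH)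

lemma sum_walshCoeff_sq (f : (Fin n → Bool) → Bool) : ∑ a, walshCoeff f a ^ 2 = 1 := by
  have h := sum_norm_sq_col ((samplingMatrix_circuit Unit).mem_unitary () f) (fun _ => false)
  simpa [samplingMatrix_apply_zero] using h

/-- A reflection whose entry at the all-zero basis state is a Walsh coefficient. -/
noncomputable def walshReflection (a : Fin n → Bool) (f : (Fin n → Bool) → Bool) :
    Matrix (Fin n → Bool) (Fin n → Bool) ℂ :=
  walshHadamard n * (phaseMatrix id (fun _ => true) f * (diagonal (walshSign a) * walshHadamard n))

lemma walshReflection_apply_zero (a : Fin n → Bool) (f : (Fin n → Bool) → Bool) :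
    walshReflection a f (fun _ => false) (fun _ => false) = walshCoeff f a := by
  rw [walshReflection, Matrix.mul_apply, walshCoeff_eq_sum]
  refine Finset.sum_congr rfl fun x _ => ?_
  rw [phaseMatrix, diagonal_mul, diagonal_mul, walshHadamard_zero_right, walshHadamard_zero_left]
  simp only [Bool.true_and, id]
  ring

lemma walshReflection_mem_unitary (a : Fin n → Bool) (f : (Fin n → Bool) → Bool) :
    walshReflection a f ∈ unitaryGroup (Fin n → Bool) ℂ :=
  mul_mem (walshHadamard_mem_unitary n) (mul_mem (phaseMatrix_mem_unitary _ _ _)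
    (mul_mem (diagonal_mem_unitary (norm_walshSign a)) (walshHadamard_mem_unitary n)))

lemma star_walshReflection (a : Fin n → Bool) (f : (Fin n → Bool) → Bool) :
    star (walshReflection a f) = walshReflection a f := by
  have h : star (phaseMatrix id (fun _ => true) f * diagonal (walshSign a)) =
      phaseMatrix id (fun _ => true) f * diagonal (walshSign a) := by
    rw [phaseMatrix, diagonal_mul_diagonal, star_eq_conjTranspose, diagonal_conjTranspose]
    congr 1
    ext y
    simp only [Pi.star_apply, star_mul', walshSign, star_prod]
    congr 1
    · split_ifs <;> simp
    · refine Finset.prod_congr rfl fun i _ => ?_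
      split_ifs <;> simp
  rw [walshReflection, ← mul_assoc (phaseMatrix _ _ _), star_mul, star_mul, star_walshHadamard, h,
    mul_assoc]

/-- Only the diagonal factors need a control: when it is off, the two Hadamard transforms cancel. -/
lemma controlled_walshReflection_circuit {A : Type} (c : A → Bool) (a : A → Fin n → Bool) :
    QueryCircuit n A (Fin n → Bool) 1 fun s f => if c s then walshReflection (a s) f else 1 := by
  have hH := QueryCircuit.gate (n := n) (fun _ : A => walshHadamard n) fun _ => walshHadamard_mem_unitary n
  have hD := QueryCircuit.gate (n := n)
    (fun s : A => if c s then diagonal (walshSign (a s)) else 1) fun s => by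
      split_ifs
      · exact diagonal_mem_unitary (norm_walshSign _)
      · exact one_mem _
  convert hH.mul ((QueryCircuit.query (fun _ => id) fun s _ => c s).mul (hD.mul hH))
    using 3 with s f
  by_cases h : c s
  · simp [h, walshReflection]
  · simp [h, phaseMatrix, walshHadamard_mul_self]

lemma controlled_walk_circuit {A : Type} (c : A → Bool) (a : A → Fin n → Bool) :
    QueryCircuit n A (Fin n → Bool) 2 fun s f =>
      if c s then walkMatrix (fun _ => false) (walshReflection (a s) f) else 1 := by
  have hV := controlled_walshReflection_circuit c a
  have hR := QueryCircuit.gate (n := n)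
    (fun s : A => if c s then basisReflection (fun _ : Fin n => false) else 1) fun s => by
      split_ifs
      · exact basisReflection_mem_unitary _
      · exact one_mem _
  have hN := QueryCircuit.gate (n := n)
    (fun s : A => if c s then (-1 : Matrix (Fin n → Bool) (Fin n → Bool) ℂ) else 1) fun s => by
      split_ifs
      · simp [mem_unitaryGroup_iff]
      · exact one_mem _
  convert hN.mul ((hR.mul hV).mul (hR.mul hV)) using 3 with s f
  by_cases h : c s <;> simp [h, walkMatrix]

/-- The exponent is part of the control, and the `m` controlled walk steps are switched on one by
one. Truncation by `min` makes the induction work and has no effect for exponents below `m`. -/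
lemma walk_pow_circuit (m : ℕ) : QueryCircuit n ((Fin n → Bool) × ℕ) (Fin n → Bool) (2 * m)
    fun s f => walkMatrix (fun _ => false) (walshReflection s.1 f) ^ min m s.2 := by
  induction m with
  | zero => simpa using QueryCircuit.one
  | succ m ih =>
    convert (controlled_walk_circuit (fun s : (Fin n → Bool) × ℕ => decide (m < s.2))
      fun s => s.1).mul ih using 1
    · ring
    · ext1 s; ext1 f
      by_cases h : m < s.2
      · rw [min_eq_left h.le, min_eq_left (Nat.succ_le_of_lt h), pow_succ']
        simp [h]
      · rw [min_eq_right (not_lt.1 h), min_eq_right ((not_lt.1 h).trans (Nat.le_succ m))]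
        simp [h]

end Walsh

lemma QueryCircuit.comap {n q : ℕ} {A B Y : Type} [Fintype Y] [DecidableEq Y]
    {S : A → ((Fin n → Bool) → Bool) → Matrix Y Y ℂ} (h : QueryCircuit n A Y q S) (g : B → A) :
    QueryCircuit n B Y q fun b f => S (g b) f := by
  induction h with
  | gate U hU => exact gate (fun b => U (g b)) fun b => hU (g b)
  | query x c => exact query (fun b => x (g b)) fun b => c (g b)
  | mul _ _ h1 h2 => exact mul h1 h2

/-- Phase estimation with a flat window, which accepts the Walsh coefficients close to
`± sin φ`. -/
lemma exists_bump_circuit (n : ℕ) {K : ℕ} (hK : 0 < K) (φ : ℝ) :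
    ∃ S, QueryCircuit n (Fin n → Bool) (Fin K × (Fin n → Bool)) (2 * K) S ∧
      ∀ a f ψ, walshCoeff f a ^ 2 = Real.sin ψ ^ 2 →
        ∑ y with y.1 = ⟨0, hK⟩, ‖S a f y (⟨0, hK⟩, fun _ => false)‖ ^ 2 =
          (fejer K (2 * ψ - 2 * φ) + fejer K (-(2 * ψ + 2 * φ))) / 2 := by
  have hK' : (0 : ℝ) < K := by exact_mod_cast hK
  have hs : ((√K : ℝ) : ℂ)⁻¹ * ((√K : ℝ) : ℂ)⁻¹ = (K : ℂ)⁻¹ := by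
    rw [← mul_inv, ← Complex.ofReal_mul, Real.mul_self_sqrt hK'.le]
    simp
  -- `U` prepares the window with phases `exp (-2 i k φ)`, and `star W` projects onto the uniform
  -- superposition when the first register is found in `0`.
  obtain ⟨U, hU, hU1⟩ := exists_unitary_col (⟨0, hK⟩ : Fin K)
    (fun k => Complex.exp (((-(2 * φ)) : ℝ) * Complex.I) ^ (k : ℕ) * ((√K)⁻¹ : ℝ)) (by
      simp only [norm_mul, norm_pow, Complex.norm_exp_ofReal_mul_I, one_pow, one_mul,
        Complex.norm_real, norm_inv]
      simp [hK'.ne'])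
  obtain ⟨W, hW, hW1⟩ := exists_unitary_col (⟨0, hK⟩ : Fin K) (fun _ => (((√K)⁻¹ : ℝ) : ℂ)) (by
      simp only [Complex.norm_real, norm_inv]
      simp [hK'.ne'])
  have hone : (1 : Matrix (Fin n → Bool) (Fin n → Bool) ℂ) ∈ unitaryGroup (Fin n → Bool) ℂ :=
    one_mem _
  have h1 := QueryCircuit.gate (n := n) (fun _ : Fin n → Bool => U.kronecker 1)
    fun _ => kronecker_mem_unitary hU hone
  have h2 := QueryCircuit.gate (n := n) (fun _ : Fin n → Bool => (star W).kronecker 1)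
    fun _ => kronecker_mem_unitary (Unitary.star_mem hW) hone
  have h3 := ((walk_pow_circuit (n := n) K).comap
    fun s : (Fin n → Bool) × Fin K => (s.1, (s.2 : ℕ))).uncurry
  refine ⟨_, by simpa using h2.mul (h3.mul h1), fun a f ψ hψ => ?_⟩
  rw [← sum_norm_sq_walk (walkMatrix_mem_unitary
    (walshReflection_mem_unitary a f)) (fun m => walkMatrix_pow_apply
    (walshReflection_mem_unitary a f) (star_walshReflection a f) (walshReflection_apply_zero a f)
    hψ m) K (2 * φ)]
  rw [Finset.sum_filter, Fintype.sum_prod_type, Finset.sum_eq_single ⟨0, hK⟩ (by simp +contextual)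
    (by simp)]
  refine Finset.sum_congr rfl fun y _ => ?_
  rw [if_pos rfl]
  congr 2
  simp only [Matrix.mul_apply, Fintype.sum_prod_type, kronecker_apply, controlled, one_apply,
    star_apply, hU1, hW1]
  simp only [mul_ite, ite_mul, mul_one, mul_zero, zero_mul, Finset.sum_ite_eq, Finset.sum_ite_eq',
    Finset.mem_univ, if_true]
  refine Finset.sum_congr rfl fun k _ => ?_
  rw [div_eq_mul_inv, ← hs]
  rw [Complex.star_def, Complex.conj_ofReal, Complex.ofReal_inv]
  rw [show ((-(2 * φ) : ℝ) : ℂ) * Complex.I = -(Complex.I * ((2 * φ : ℝ) : ℂ)) by push_cast; ring]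
  ring

lemma QueryCircuit.kronecker {n q : ℕ} {A Y E : Type} [Fintype Y] [DecidableEq Y] [Fintype E]
    [DecidableEq E] {S : A → ((Fin n → Bool) → Bool) → Matrix Y Y ℂ}
    (h : QueryCircuit n A Y q S) :
    QueryCircuit n A (Y × E) q fun a f => (S a f).kronecker 1 := by
  have hone : (1 : Matrix E E ℂ) ∈ unitaryGroup E ℂ := one_mem _
  induction h with
  | gate U hU =>
    exact gate (fun a => (U a).kronecker 1) fun a => kronecker_mem_unitary (hU a) hone
  | query x c =>
    convert query (n := n) (A := A) (Y := Y × E) (fun a z => x a z.1) (fun a z => c a z.1)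
      using 3 with a f
    simp only [phaseMatrix]
    rw [← diagonal_one]
    simp only [Matrix.kronecker]
    rw [kroneckerMap_diagonal_diagonal _ (by simp) (by simp)]
    simp
  | mul _ _ h1 h2 =>
    convert mul h1 h2 using 3 with a f
    simp only [Matrix.kronecker]
    rw [← mul_kronecker_mul, one_mul]

/-! ### Amplitude amplification -/

section Amplify

variable {Y : Type} [Fintype Y] [DecidableEq Y] (flag : Y → Prop) [DecidablePred flag] (z : Y)

/-- The probability of a flagged outcome after applying `U` to the basis state `z`. -/
noncomputable def flagProb (U : Matrix Y Y ℂ) : ℝ := ∑ y with flag y, ‖U y z‖ ^ 2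

lemma flagProb_nonneg (U : Matrix Y Y ℂ) : 0 ≤ flagProb flag z U :=
  Finset.sum_nonneg fun _ _ => by positivity

variable {z}

lemma flagProb_le_one {U : Matrix Y Y ℂ} (hU : U ∈ unitaryGroup Y ℂ) : flagProb flag z U ≤ 1 := by
  rw [← sum_norm_sq_col hU z]
  exact Finset.sum_le_sum_of_subset_of_nonneg (Finset.filter_subset _ _) fun _ _ _ => by positivity

variable (z)

/-- The reflection that changes the sign of the flagged states. -/
def flagReflection : Matrix Y Y ℂ := diagonal fun y => if flag y then -1 else 1

lemma flagReflection_mem_unitary : flagReflection flag ∈ unitaryGroup Y ℂ :=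
  diagonal_mem_unitary fun y => by split_ifs <;> simp

/-- One round of amplitude amplification. -/
def amplify (U : Matrix Y Y ℂ) : Matrix Y Y ℂ :=
  U * (basisReflection z * (star U * (flagReflection flag * U)))

variable {z}

lemma amplify_mem_unitary {U : Matrix Y Y ℂ} (hU : U ∈ unitaryGroup Y ℂ) :
    amplify flag z U ∈ unitaryGroup Y ℂ :=
  mul_mem hU (mul_mem (basisReflection_mem_unitary z) (mul_mem (Unitary.star_mem hU)
    (mul_mem (flagReflection_mem_unitary flag) hU)))

lemma star_mulVec_flagReflection {U : Matrix Y Y ℂ} (hU : U ∈ unitaryGroup Y ℂ) :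
    (star U *ᵥ (flagReflection flag *ᵥ (U *ᵥ Pi.single z 1))) z =
      ((1 - 2 * flagProb flag z U : ℝ) : ℂ) := by
  have h1 := Finset.sum_filter_add_sum_filter_not Finset.univ flag fun y => ‖U y z‖ ^ 2
  rw [sum_norm_sq_col hU] at h1
  have h2 : (1 - 2 * flagProb flag z U : ℝ) = ∑ y, (if flag y then -1 else 1) * ‖U y z‖ ^ 2 := by
    simp only [ite_mul, Finset.sum_ite, ← Finset.mul_sum]
    unfold flagProb
    linarith
  have h3 : flagReflection flag *ᵥ (U *ᵥ Pi.single z 1) =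
      fun y => (if flag y then -1 else 1) * U y z := by
    ext y
    rw [flagReflection, mulVec_diagonal]
    simp
  rw [h2, h3]
  simp only [mulVec, dotProduct, star_apply]
  push_cast
  refine Finset.sum_congr rfl fun y _ => ?_
  rw [← Complex.conj_mul', Complex.star_def]
  split_ifs <;> (push_cast; ring)

/-- On flagged states one round multiplies amplitudes by `3 - 4p`; with `p = sin² φ` this is the
triple-angle formula. -/
lemma flagProb_amplify {U : Matrix Y Y ℂ} (hU : U ∈ unitaryGroup Y ℂ) :
    flagProb flag z (amplify flag z U) =
      flagProb flag z U * (3 - 4 * flagProb flag z U) ^ 2 := by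
  have h4 : amplify flag z U *ᵥ Pi.single z 1 =
      (2 * ((1 - 2 * flagProb flag z U : ℝ) : ℂ)) • (U *ᵥ Pi.single z 1) -
        flagReflection flag *ᵥ (U *ᵥ Pi.single z 1) := by
    simp only [amplify, ← mulVec_mulVec]
    rw [basisReflection_mulVec, star_mulVec_flagReflection flag hU, mulVec_sub, mulVec_smul,
      mulVec_mulVec _ U (star U), mem_unitaryGroup_iff.1 hU, one_mulVec]
  have key : ∀ y, flag y →
      amplify flag z U y z = ((3 - 4 * flagProb flag z U : ℝ) : ℂ) * U y z := by
    intro y hy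
    have h5 := congrFun h4 y
    rw [mulVec_single_one, col_apply, Pi.sub_apply, flagReflection, mulVec_diagonal, if_pos hy] at h5
    simp only [Pi.smul_apply, mulVec_single_one, col_apply, smul_eq_mul] at h5
    rw [h5]
    push_cast
    ring
  have : flagProb flag z (amplify flag z U) =
      ∑ y with flag y, ‖U y z‖ ^ 2 * (3 - 4 * flagProb flag z U) ^ 2 := by
    refine Finset.sum_congr rfl fun y hy => ?_
    rw [key y (Finset.mem_filter.1 hy).2, norm_mul, Complex.norm_real, mul_pow, Real.norm_eq_abs,
      sq_abs, mul_comm]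
  rw [this, ← Finset.sum_mul, ← flagProb]

lemma amplify_iterate_mem_unitary {U : Matrix Y Y ℂ} (hU : U ∈ unitaryGroup Y ℂ) (i : ℕ) :
    (amplify flag z)^[i] U ∈ unitaryGroup Y ℂ := by
  induction i with
  | zero => exact hU
  | succ i ih =>
    rw [Function.iterate_succ_apply']
    exact amplify_mem_unitary flag ih

lemma flagProb_amplify_iterate {U : Matrix Y Y ℂ} (hU : U ∈ unitaryGroup Y ℂ) {φ : ℝ}
    (h : flagProb flag z U = Real.sin φ ^ 2) (i : ℕ) :
    flagProb flag z ((amplify flag z)^[i] U) = Real.sin (3 ^ i * φ) ^ 2 := by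
  induction i with
  | zero => simpa using h
  | succ i ih =>
    rw [Function.iterate_succ_apply',
      flagProb_amplify flag (amplify_iterate_mem_unitary flag hU i), ih, pow_succ' 3 i, mul_assoc 3,
      Real.sin_three_mul]
    ring

lemma flagProb_amplify_iterate_le {U : Matrix Y Y ℂ} (hU : U ∈ unitaryGroup Y ℂ) (i : ℕ) :
    flagProb flag z ((amplify flag z)^[i] U) ≤ 9 ^ i * flagProb flag z U := by
  induction i with
  | zero => simp
  | succ i ih =>
    have hi := amplify_iterate_mem_unitary flag (z := z) hU i
    rw [Function.iterate_succ_apply', flagProb_amplify flag hi]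
    have h0 := flagProb_nonneg flag z ((amplify flag z)^[i] U)
    have h1 := flagProb_le_one flag (z := z) hi
    have h2 : (3 - 4 * flagProb flag z ((amplify flag z)^[i] U)) ^ 2 ≤ 9 := by nlinarith
    calc _ ≤ flagProb flag z ((amplify flag z)^[i] U) * 9 := mul_le_mul_of_nonneg_left h2 h0
      _ ≤ _ := by rw [pow_succ]; linarith

lemma amplify_iterate_circuit {n q : ℕ} {A : Type}
    {S : A → ((Fin n → Bool) → Bool) → Matrix Y Y ℂ} (h : QueryCircuit n A Y q S) (i : ℕ) :
    QueryCircuit n A Y (3 ^ i * q) fun a f => (amplify flag z)^[i] (S a f) := by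
  induction i with
  | zero => simpa using h
  | succ i ih =>
    have h1 := QueryCircuit.gate (n := n) (fun _ : A => basisReflection z)
      fun _ => basisReflection_mem_unitary _
    have h2 := QueryCircuit.gate (n := n) (fun _ : A => flagReflection flag)
      fun _ => flagReflection_mem_unitary flag
    simp only [Function.iterate_succ_apply', amplify]
    convert ih.mul (h1.mul (ih.star.mul (h2.mul ih))) using 1
    ring

/-- If the initial amplitude is at least `(π / 6) / 3 ^ I`, then some number of rounds up to `I`
makes it at least `1 / 2`. -/
lemma exists_le_flagProb_amplify {U : Matrix Y Y ℂ} (hU : U ∈ unitaryGroup Y ℂ) {I : ℕ}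
    (h : (Real.pi / 6 / 3 ^ I) ^ 2 ≤ flagProb flag z U) :
    ∃ i ≤ I, 1 / 4 ≤ flagProb flag z ((amplify flag z)^[i] U) := by
  set s := √(flagProb flag z U) with hs
  have hs1 : s ≤ 1 := Real.sqrt_le_one.2 (flagProb_le_one flag hU)
  have hs0 : 0 ≤ s := Real.sqrt_nonneg _
  have hφ : flagProb flag z U = Real.sin (Real.arcsin s) ^ 2 := by
    rw [Real.sin_arcsin (by linarith) hs1, Real.sq_sqrt (flagProb_nonneg flag z U)]
  set φ := Real.arcsin s with hφd
  have hφ0 : 0 ≤ φ := Real.arcsin_nonneg.2 hs0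
  have hφ1 : φ ≤ Real.pi / 2 := Real.arcsin_le_pi_div_two _
  have hpi := Real.pi_pos
  have hI : Real.pi / 6 ≤ 3 ^ I * φ := by
    have h1 : Real.pi / 6 / 3 ^ I ≤ s := Real.le_sqrt_of_sq_le h
    have h2 : s ≤ φ := by
      have := Real.sin_le hφ0
      rwa [hφd, Real.sin_arcsin (by linarith) hs1, ← hφd] at this
    have h3 := h1.trans h2
    rwa [div_le_iff₀ (by positivity), mul_comm] at h3
  classical
  -- The first angle to reach `π / 6` cannot exceed `π / 2`, since it is at most `π / 2` initially
  -- and otherwise three times an angle below `π / 6`.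
  have hex : ∃ i : ℕ, Real.pi / 6 ≤ 3 ^ i * φ := ⟨I, hI⟩
  refine ⟨Nat.find hex, Nat.find_min' _ hI, ?_⟩
  have h1 := Nat.find_spec hex
  have h2 : 3 ^ Nat.find hex * φ ≤ Real.pi / 2 := by
    rcases hi : Nat.find hex with _ | i
    · simpa using hφ1
    · have := Nat.find_min hex (m := i) (by omega)
      rw [pow_succ]
      linarith
  rw [flagProb_amplify_iterate flag hU hφ]
  have h3 : 1 / 2 ≤ Real.sin (3 ^ Nat.find hex * φ) := by
    rw [← Real.sin_pi_div_six]
    exact Real.sin_le_sin_of_le_of_le_pi_div_two (by linarith) h2 h1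
  nlinarith

end Amplify

/-! ### Parallel runs -/

section Parallel

variable {ι Y : Type} [Fintype ι] [DecidableEq ι] [Fintype Y] [DecidableEq Y]
  (flag : Y → Prop) [DecidablePred flag] (z : Y)

lemma norm_sq_piKron (U : ι → Matrix Y Y ℂ) (y : ι → Y) :
    ‖piKron U y (fun _ => z)‖ ^ 2 = ∏ i, ‖U i (y i) z‖ ^ 2 := by
  simp [piKron, Finset.prod_pow]

lemma flagProb_exists [DecidablePred fun y : ι → Y => ∃ i, flag (y i)] (U : ι → Matrix Y Y ℂ)
    (hU : ∀ i, U i ∈ unitaryGroup Y ℂ) :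
    flagProb (fun y : ι → Y => ∃ i, flag (y i)) (fun _ => z) (piKron U) =
      1 - ∏ i, (1 - flagProb flag z (U i)) := by
  have h1 := Finset.sum_filter_add_sum_filter_not Finset.univ (fun y : ι → Y => ∃ i, flag (y i))
    fun y => ‖piKron U y (fun _ => z)‖ ^ 2
  rw [sum_norm_sq_col (piKron_mem_unitary hU)] at h1
  have h2 : ∀ i, 1 - flagProb flag z (U i) = ∑ y with ¬ flag y, ‖U i y z‖ ^ 2 := fun i => by
    have := Finset.sum_filter_add_sum_filter_not Finset.univ flag fun y => ‖U i y z‖ ^ 2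
    rw [sum_norm_sq_col (hU i)] at this
    rw [flagProb]
    linarith
  have h3 : ∏ i, (1 - flagProb flag z (U i)) =
      ∑ y : ι → Y with ¬ ∃ i, flag (y i), ‖piKron U y (fun _ => z)‖ ^ 2 := by
    simp only [h2, norm_sq_piKron]
    rw [Finset.prod_univ_sum]
    refine Finset.sum_congr ?_ fun _ _ => rfl
    ext y
    simp [Fintype.mem_piFinset]
  rw [h3, flagProb]
  linarith

/-- The right number of amplification rounds is unknown, so all are tried in parallel; one good run
suffices. -/
lemma le_flagProb_exists [DecidablePred fun y : ι → Y => ∃ i, flag (y i)] {U : ι → Matrix Y Y ℂ}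
    (hU : ∀ i, U i ∈ unitaryGroup Y ℂ) (i : ι) :
    flagProb flag z (U i) ≤
      flagProb (fun y : ι → Y => ∃ i, flag (y i)) (fun _ => z) (piKron U) := by
  rw [flagProb_exists flag z U hU, ← Finset.mul_prod_erase _ _ (Finset.mem_univ i)]
  have h0 := fun j => flagProb_nonneg flag z (U j)
  have h1 := fun j => flagProb_le_one flag (z := z) (hU j)
  have h2 : ∏ j ∈ Finset.univ.erase i, (1 - flagProb flag z (U j)) ≤ 1 :=
    Finset.prod_le_one (fun j _ => by linarith [h1 j]) fun j _ => by linarith [h0 j]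
  nlinarith [h1 i]

lemma flagProb_exists_le [DecidablePred fun y : ι → Y => ∃ i, flag (y i)] {U : ι → Matrix Y Y ℂ}
    (hU : ∀ i, U i ∈ unitaryGroup Y ℂ) :
    flagProb (fun y : ι → Y => ∃ i, flag (y i)) (fun _ => z) (piKron U) ≤
      ∑ i, flagProb flag z (U i) := by
  rw [flagProb_exists flag z U hU]
  -- Union bound, in the form of Weierstrass' product inequality.
  have key : ∀ s : Finset ι, 1 - ∑ i ∈ s, flagProb flag z (U i) ≤
      ∏ i ∈ s, (1 - flagProb flag z (U i)) := by
    intro s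
    induction s using Finset.induction_on with
    | empty => simp
    | insert i s hi ih =>
      rw [Finset.sum_insert hi, Finset.prod_insert hi]
      have h0 := flagProb_nonneg flag z (U i)
      have h1 : ∏ j ∈ s, (1 - flagProb flag z (U j)) ≤ 1 :=
        Finset.prod_le_one (fun j _ => by linarith [flagProb_le_one flag (z := z) (hU j)])
          fun j _ => by linarith [flagProb_nonneg flag z (U j)]
      nlinarith
  linarith [key Finset.univ]

lemma flagProb_vote_le {U : Matrix Y Y ℂ} (hU : U ∈ unitaryGroup Y ℂ)
    (h : flagProb flag z U ≤ 1 / 1024) :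
    flagProb (fun y : ι → Y => Vote flag y) (fun _ => z) (piKron fun _ => U) ≤
      (97 / 100) ^ Fintype.card ι := by
  simp only [flagProb, norm_sq_piKron]
  exact sum_vote_le flag (fun y => ‖U y z‖ ^ 2) (fun _ => by positivity) (sum_norm_sq_col hU z) h

lemma one_sub_le_flagProb_vote {U : Matrix Y Y ℂ} (hU : U ∈ unitaryGroup Y ℂ)
    (h : 1 / 4 ≤ flagProb flag z U) :
    1 - (97 / 100) ^ Fintype.card ι ≤
      flagProb (fun y : ι → Y => Vote flag y) (fun _ => z) (piKron fun _ => U) := by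
  simp only [flagProb, norm_sq_piKron]
  exact one_sub_le_sum_vote flag (fun y => ‖U y z‖ ^ 2) (fun _ => by positivity)
    (sum_norm_sq_col hU z) h

end Parallel

/-! ### Detecting a large Walsh coefficient -/

/-- The acceptance probability of phase estimation around `φ` for a coefficient `± sin ψ`. -/
noncomputable def bumpProb (K : ℕ) (φ ψ : ℝ) : ℝ :=
  (fejer K (2 * ψ - 2 * φ) + fejer K (-(2 * ψ + 2 * φ))) / 2

lemma le_bumpProb {K : ℕ} (hK : 0 < K) {φ ψ h : ℝ} (hψ : |ψ - φ| ≤ h) (hKh : K * h ≤ 1 / 4) :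
    1 / 4 ≤ bumpProb K φ ψ := by
  have h1 : 1 / 2 ≤ fejer K (2 * ψ - 2 * φ) := by
    refine half_le_fejer hK ?_
    rw [← mul_sub, abs_mul, abs_two]
    have := mul_le_mul_of_nonneg_left hψ (Nat.cast_nonneg (α := ℝ) K)
    linarith
  have h2 := fejer_nonneg K (-(2 * ψ + 2 * φ))
  unfold bumpProb
  linarith

lemma bumpProb_le {K : ℕ} (hK : 0 < K) {φ ψ D : ℝ} (hψ : 0 ≤ ψ) (hφ : φ ≤ Real.pi / 2)
    (hD : 0 < D) (h : ψ + D ≤ φ) (hKD : 16 * Real.pi ≤ K * D) :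
    bumpProb K φ ψ ≤ 1 / 1024 := by
  have hpi := Real.pi_pos
  have hs : 2 / Real.pi * D ≤ Real.sin (φ - ψ) :=
    (mul_le_mul_of_nonneg_left (by linarith) (by positivity)).trans
      (Real.mul_le_sin (by linarith) (by linarith))
  have hs' : 0 < 2 / Real.pi * D := by positivity
  have hb : 1 / (K * (2 / Real.pi * D)) ^ 2 ≤ 1 / 1024 := by
    have : 32 ≤ K * (2 / Real.pi * D) := by
      have e : K * (2 / Real.pi * D) = 2 * (K * D) / Real.pi := by ring
      rw [e, le_div_iff₀ hpi]
      linarith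
    rw [div_le_div_iff₀ (by positivity) (by norm_num)]
    nlinarith
  have h1 : fejer K (2 * ψ - 2 * φ) ≤ 1 / 1024 := by
    refine (fejer_le hK hs' ?_).trans hb
    rw [show (2 * ψ - 2 * φ) / 2 = -(φ - ψ) by ring, Real.sin_neg, abs_neg]
    exact hs.trans (le_abs_self _)
  have h2 : fejer K (-(2 * ψ + 2 * φ)) ≤ 1 / 1024 := by
    refine (fejer_le hK hs' ?_).trans hb
    rw [show -(2 * ψ + 2 * φ) / 2 = -(φ + ψ) by ring, Real.sin_neg, abs_neg]
    -- The mirror image `-ψ` is even further from `φ`: `sin (φ + ψ) ≥ sin (φ - ψ)` because `cos φ`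
    -- and `sin ψ` are nonnegative.
    refine (hs.trans ?_).trans (le_abs_self _)
    rw [Real.sin_sub, Real.sin_add]
    have h3 : 0 ≤ Real.cos φ := Real.cos_nonneg_of_neg_pi_div_two_le_of_le (by linarith) hφ
    have h4 : 0 ≤ Real.sin ψ := Real.sin_nonneg_of_nonneg_of_le_pi hψ (by linarith)
    nlinarith
  unfold bumpProb
  linarith

/-- A superposition over the labels `a`, with amplitudes `walshCoeff f a`, in which the labels whose
coefficient is close to `± sin φ` are flagged. -/
lemma exists_filter_circuit (n : ℕ) {K : ℕ} (hK : 0 < K) (φ : ℝ) (r : ℕ) :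
    ∃ (Z : Type) (_ : Fintype Z) (_ : DecidableEq Z)
      (S : ((Fin n → Bool) → Bool) → Matrix Z Z ℂ) (z : Z) (flag : Z → Prop)
      (_ : DecidablePred flag),
      QueryCircuit n Unit Z (2 * K * r + 1) (fun _ f => S f) ∧
      ∀ f (ψ : (Fin n → Bool) → ℝ), (∀ a, walshCoeff f a ^ 2 = Real.sin (ψ a) ^ 2) →
        ((∀ a, bumpProb K φ (ψ a) ≤ 1 / 1024) → flagProb flag z (S f) ≤ (97 / 100) ^ r) ∧
        ∀ a, 1 / 4 ≤ bumpProb K φ (ψ a) →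
          walshCoeff f a ^ 2 * (1 - (97 / 100) ^ r) ≤ flagProb flag z (S f) := by
  obtain ⟨T, hT, hTp⟩ := exists_bump_circuit n hK φ
  have hP := QueryCircuit.parallel (ι := Fin r) fun _ => hT
  have hC := (hP.comap (fun s : Unit × (Fin n → Bool) => s.2)).uncurry
  have hS := (samplingMatrix_circuit (n := n) Unit).kronecker (E := Fin r → Fin K × (Fin n → Bool))
  let z₁ : Fin K × (Fin n → Bool) := (⟨0, hK⟩, fun _ => false)
  let flag₁ : Fin K × (Fin n → Bool) → Prop := fun y => y.1 = ⟨0, hK⟩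
  refine ⟨(Fin n → Bool) × (Fin r → Fin K × (Fin n → Bool)), inferInstance, inferInstance,
    fun f => (controlled fun b => piKron fun _ : Fin r => T b f) * (samplingMatrix f).kronecker 1,
    (fun _ => false, fun _ => z₁), fun y => Vote flag₁ y.2, inferInstance,
    by convert hC.mul hS using 1; simp; ring, fun f ψ hψ => ?_⟩
  set M := (controlled fun b => piKron fun _ : Fin r => T b f) * (samplingMatrix f).kronecker 1
    with hM
  -- The label register is only a control after sampling, so the flagged weight is the average of
  -- the vote probabilities under the distribution `f̂(a)²`.
  have hMz : ∀ a y, M (a, y) (fun _ => false, fun _ => z₁) =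
      piKron (fun _ : Fin r => T a f) y (fun _ => z₁) * walshCoeff f a := by
    intro a y
    rw [hM, Matrix.mul_apply, Fintype.sum_prod_type]
    simp only [controlled]
    simp [one_apply, samplingMatrix_apply_zero]
  have hU : ∀ a, T a f ∈ unitaryGroup _ ℂ := fun a => hT.mem_unitary a f
  have hp : flagProb (fun y : (Fin n → Bool) × (Fin r → Fin K × (Fin n → Bool)) => Vote flag₁ y.2)
      (fun _ => false, fun _ => z₁) M = ∑ a, walshCoeff f a ^ 2 *
        flagProb (fun y : Fin r → _ => Vote flag₁ y) (fun _ => z₁) (piKron fun _ => T a f) := by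
    simp only [flagProb, Finset.sum_filter, Fintype.sum_prod_type, Finset.mul_sum]
    refine Finset.sum_congr rfl fun a _ => Finset.sum_congr rfl fun y _ => ?_
    rw [hMz, norm_mul, mul_pow, Complex.norm_real, Real.norm_eq_abs, sq_abs]
    split_ifs
    · ring
    · simp
  have hb : ∀ a, flagProb flag₁ z₁ (T a f) = bumpProb K φ (ψ a) := fun a => hTp a f _ (hψ a)
  constructor
  · intro h
    calc _ = _ := hp
      _ ≤ ∑ a, walshCoeff f a ^ 2 * (97 / 100) ^ r := by
        refine Finset.sum_le_sum fun a _ => mul_le_mul_of_nonneg_left ?_ (sq_nonneg _)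
        simpa using flagProb_vote_le (ι := Fin r) flag₁ z₁ (hU a) ((hb a).trans_le (h a))
      _ = _ := by rw [← Finset.sum_mul, sum_walshCoeff_sq, one_mul]
  · intro a h
    calc _ ≤ walshCoeff f a ^ 2 *
        flagProb (fun y : Fin r → _ => Vote flag₁ y) (fun _ => z₁) (piKron fun _ => T a f) := by
          refine mul_le_mul_of_nonneg_left ?_ (sq_nonneg _)
          simpa using one_sub_le_flagProb_vote (ι := Fin r) flag₁ z₁ (hU a) (h.trans_eq (hb a).symm)
      _ ≤ ∑ a, walshCoeff f a ^ 2 *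
        flagProb (fun y : Fin r → _ => Vote flag₁ y) (fun _ => z₁) (piKron fun _ => T a f) :=
          Finset.single_le_sum (f := fun a => walshCoeff f a ^ 2 *
            flagProb (fun y : Fin r → _ => Vote flag₁ y) (fun _ => z₁) (piKron fun _ => T a f))
            (fun a _ => mul_nonneg (sq_nonneg _) (flagProb_nonneg _ _ _)) (Finset.mem_univ a)
      _ = _ := hp.symm

/-- Repeated amplitude amplification tells a large flagged weight from a small one. -/
lemma exists_vote_circuit {n q : ℕ} {Z : Type} [Fintype Z] [DecidableEq Z]
    {S : ((Fin n → Bool) → Bool) → Matrix Z Z ℂ} (z : Z) (flag : Z → Prop) [DecidablePred flag]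
    (h : QueryCircuit n Unit Z q fun _ f => S f) (I R : ℕ) :
    ∃ (Y : Type) (_ : Fintype Y) (_ : DecidableEq Y)
      (T : ((Fin n → Bool) → Bool) → Matrix Y Y ℂ) (y : Y) (flag' : Y → Prop)
      (_ : DecidablePred flag') (p : ℕ), 2 * p ≤ R * (3 ^ (I + 1) * q) ∧
      QueryCircuit n Unit Y p (fun _ f => T f) ∧
      ∀ f, (9 ^ (I + 1) * flagProb flag z (S f) ≤ 8 / 1024 →
          flagProb flag' y (T f) ≤ (97 / 100) ^ R) ∧
        ((Real.pi / 6 / 3 ^ I) ^ 2 ≤ flagProb flag z (S f) →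
          1 - (97 / 100) ^ R ≤ flagProb flag' y (T f)) := by
  have h1 := QueryCircuit.parallel (ι := Fin (I + 1))
    fun i => amplify_iterate_circuit flag (z := z) h i
  have h2 := QueryCircuit.parallel (ι := Fin R) fun _ => h1
  -- The tripling numbers of uses form a geometric sum, so trying every `i ≤ I` costs little more
  -- than the last one.
  have hp : (∑ i : Fin (I + 1), 3 ^ (i : ℕ) * q) * 2 ≤ 3 ^ (I + 1) * q := by
    rw [← Finset.sum_mul, Fin.sum_univ_eq_sum_range (fun i => 3 ^ i), mul_right_comm]
    refine Nat.mul_le_mul_right q ?_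
    have := Nat.geomSum_eq (m := 3) (by norm_num) (I + 1)
    rw [this]
    exact (Nat.div_mul_le_self _ 2).trans (Nat.sub_le _ _)
  refine ⟨_, _, _, _, fun _ _ => z,
    fun y : Fin R → Fin (I + 1) → Z => Vote (fun y => ∃ i, flag (y i)) y,
    inferInstance, _, ?_, h2, fun f => ?_⟩
  · simp only [Finset.sum_const, Finset.card_univ, Fintype.card_fin, smul_eq_mul]
    nlinarith
  have hU : S f ∈ unitaryGroup Z ℂ := h.mem_unitary () f
  have hUi : ∀ i : Fin (I + 1), (amplify flag z)^[i] (S f) ∈ unitaryGroup Z ℂ :=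
    fun i => amplify_iterate_mem_unitary flag hU i
  have hUp := piKron_mem_unitary hUi
  constructor
  · intro hs
    have hle : flagProb (fun y : Fin (I + 1) → Z => ∃ i, flag (y i)) (fun _ => z)
        (piKron fun i : Fin (I + 1) => (amplify flag z)^[i] (S f)) ≤ 1 / 1024 := by
      refine (flagProb_exists_le flag z hUi).trans ?_
      calc ∑ i : Fin (I + 1), flagProb flag z ((amplify flag z)^[i] (S f))
          ≤ ∑ i : Fin (I + 1), 9 ^ (i : ℕ) * flagProb flag z (S f) :=
            Finset.sum_le_sum fun i _ => flagProb_amplify_iterate_le flag hU i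
        _ = (9 ^ (I + 1) - 1) / (9 - 1) * flagProb flag z (S f) := by
            rw [← Finset.sum_mul, Fin.sum_univ_eq_sum_range (fun i => (9 : ℝ) ^ i),
              geom_sum_eq (by norm_num)]
        _ ≤ 1 / 1024 := by
            have := flagProb_nonneg flag z (S f)
            linarith
    simpa using flagProb_vote_le (ι := Fin R) _ _ hUp hle
  · intro hs
    obtain ⟨i, hi, hi2⟩ := exists_le_flagProb_amplify flag hU hs
    have hle := le_flagProb_exists flag z hUi ⟨i, Nat.lt_succ_of_le hi⟩
    simpa using one_sub_le_flagProb_vote (ι := Fin R) _ _ hUp (hi2.trans hle)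

/-- The factor `34` works because `log (97 / 100) ≤ -3 / 100` and `34 * 3 ≥ 100`. -/
lemma exists_pow_le {x : ℝ} (hx : 0 < x) (hx1 : x ≤ 1) :
    ∃ r : ℕ, (97 / 100 : ℝ) ^ r ≤ x ∧ (r : ℝ) ≤ 34 * Real.log (1 / x) + 1 := by
  have hl : 0 ≤ Real.log (1 / x) := Real.log_nonneg (by rw [le_div_iff₀ hx]; linarith)
  refine ⟨⌈34 * Real.log (1 / x)⌉₊, ?_, (Nat.ceil_lt_add_one (by positivity)).le⟩
  have h1 := Nat.le_ceil (34 * Real.log (1 / x))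
  set r := ⌈34 * Real.log (1 / x)⌉₊
  have h2 : Real.log (97 / 100) ≤ -(3 / 100) :=
    (Real.log_le_sub_one_of_pos (by norm_num)).trans (by norm_num)
  rw [← Real.log_le_log_iff (by positivity) hx, Real.log_pow]
  rw [one_div, Real.log_inv] at h1 hl
  have hr : (0 : ℝ) ≤ r := Nat.cast_nonneg r
  nlinarith

/-! ### Bounds on the largest Walsh coefficient -/

section walshMax

variable {n : ℕ} (f : (Fin n → Bool) → Bool)

lemma abs_walshCoeff_le_walshMax (a : Fin n → Bool) : |walshCoeff f a| ≤ walshMax f :=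
  Finset.le_sup' (fun a => |walshCoeff f a|) (Finset.mem_univ a)

lemma exists_abs_walshCoeff_eq : ∃ a, |walshCoeff f a| = walshMax f := by
  obtain ⟨a, _, h⟩ := Finset.exists_mem_eq_sup' Finset.univ_nonempty
    fun a : Fin n → Bool => |walshCoeff f a|
  exact ⟨a, h.symm⟩

lemma abs_walshCoeff_le_one (a : Fin n → Bool) : |walshCoeff f a| ≤ 1 := by
  rw [← sq_le_one_iff_abs_le_one, ← sum_walshCoeff_sq f]
  exact Finset.single_le_sum (f := fun a => walshCoeff f a ^ 2) (fun _ _ => sq_nonneg _)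
    (Finset.mem_univ a)

lemma walshMax_le_one : walshMax f ≤ 1 := by
  obtain ⟨a, h⟩ := exists_abs_walshCoeff_eq f
  exact h ▸ abs_walshCoeff_le_one f a

lemma walshMax_pos : 0 < walshMax f := by
  by_contra h
  have h0 : ∀ a, walshCoeff f a = 0 := fun a =>
    abs_nonpos_iff.1 ((abs_walshCoeff_le_walshMax f a).trans (not_lt.1 h))
  have := sum_walshCoeff_sq f
  simp [h0] at this

end walshMax

/-- A circuit that tells whether `arcsin (walshMax f)` is at the upper or at the lower end of the
interval `[u - L, u]`. -/
lemma exists_test_circuit : ∃ C₀ : ℝ, 0 < C₀ ∧ ∀ (n : ℕ) (u L δ : ℝ), 0 < L → L ≤ u →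
    u ≤ Real.pi / 2 → 0 < δ → δ ≤ 1 / 2 →
    ∃ (Y : Type) (_ : Fintype Y) (_ : DecidableEq Y)
      (T : ((Fin n → Bool) → Bool) → Matrix Y Y ℂ) (y : Y) (flag : Y → Prop)
      (_ : DecidablePred flag) (p : ℕ),
      QueryCircuit n Unit Y p (fun _ f => T f) ∧
      (p : ℝ) ≤ C₀ / (u * L) * Real.log (8 / L) * Real.log (2 / δ) ∧
      ∀ f, (u - L / 128 ≤ Real.arcsin (walshMax f) → Real.arcsin (walshMax f) ≤ u →
          1 - δ ≤ flagProb flag y (T f)) ∧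
        (Real.arcsin (walshMax f) ≤ u - 127 / 128 * L → flagProb flag y (T f) ≤ δ) := by
  refine ⟨30000000, by norm_num, fun n u L δ hL hLu hu hδ hδ1 => ?_⟩
  have hpi := Real.pi_gt_three
  have hpi' := Real.pi_lt_d2
  have hu0 : 0 < u := hL.trans_le hLu
  -- Then `60 ≤ K L ≤ 62`: small enough to accept angles within `L / 256` (needs `K L ≤ 64`), large
  -- enough to reject at distance `253 / 256 * L` (needs `16 π`).
  set K := ⌈60 / L⌉₊ with hKdef
  have hKl : 60 ≤ K * L := by
    have := Nat.le_ceil (60 / L)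
    rwa [div_le_iff₀ hL] at this
  have hKu : K * L ≤ 62 := by
    have := (Nat.ceil_lt_add_one (by positivity : 0 ≤ 60 / L)).le
    have h2 := mul_le_mul_of_nonneg_right this hL.le
    rw [add_mul, div_mul_cancel₀ _ hL.ne'] at h2
    linarith
  have hK : 0 < K := Nat.ceil_pos.2 (by positivity)
  obtain ⟨m, hm, hm'⟩ := exists_nat_pow_near (x := 4 / u) (y := 3)
    (by rw [le_div_iff₀ hu0]; linarith) (by norm_num)
  -- False acceptance must survive amplification by up to `1296 / u ^ 2`; `1296 / 2 ^ 18` is below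
  -- `8 / 1024`.
  obtain ⟨r, hr, hr'⟩ := exists_pow_le (x := u ^ 2 / 2 ^ 18) (by positivity) (by
    rw [div_le_one (by norm_num)]
    nlinarith)
  obtain ⟨R, hR, hR'⟩ := exists_pow_le hδ (by linarith)
  -- The window is centred in the top piece `[u - L / 128, u]`.
  obtain ⟨Z, _, _, S, z, flag, _, hS, hSp⟩ := exists_filter_circuit n hK (u - L / 256) r
  obtain ⟨Y, i1, i2, T, y, flag', i3, p, hp, hT, hTp⟩ := exists_vote_circuit z flag hS (m + 1) R
  refine ⟨Y, i1, i2, T, y, flag', i3, p, hT, ?_, fun f => ?_⟩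
  · set Λ := Real.log (8 / L) with hΛ
    set Δ := Real.log (2 / δ) with hΔ
    have hΛ1 : 1 ≤ Λ := by
      rw [hΛ, Real.le_log_iff_exp_le (by positivity), le_div_iff₀ hL]
      have := Real.exp_one_lt_d9
      nlinarith
    have hΔ1 : 1 ≤ Δ := by
      rw [hΔ, Real.le_log_iff_exp_le (by positivity), le_div_iff₀ hδ]
      have := Real.exp_one_lt_d9
      nlinarith
    have hr2 : (r : ℝ) ≤ 273 * Λ := by
      have h1 : Real.log (1 / (u ^ 2 / 2 ^ 18)) ≤ 8 * Λ := by
        rw [show (8 : ℝ) * Λ = (8 : ℕ) * Λ by norm_num, hΛ, ← Real.log_pow]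
        refine Real.log_le_log (by positivity) ?_
        calc 1 / (u ^ 2 / 2 ^ 18) ≤ (8 / u) ^ 8 := by
              rw [div_pow, one_div_div, div_le_div_iff₀ (by positivity) (by positivity)]
              have h3 : u ^ 6 ≤ 2 ^ 6 := pow_le_pow_left₀ hu0.le (by linarith) 6
              have h4 : 0 < u ^ 2 := by positivity
              nlinarith
          _ ≤ (8 / L) ^ 8 := by gcongr
      linarith
    have hR2 : (R : ℝ) ≤ 35 * Δ := by
      have : Real.log (1 / δ) ≤ Δ := Real.log_le_log (by positivity) (by gcongr; norm_num)
      linarith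
    have hI : (3 : ℝ) ^ (m + 1 + 1) ≤ 36 / u := by
      rw [pow_succ, pow_succ]
      have : 36 / u = 4 / u * 3 * 3 := by ring
      rw [this]
      gcongr
    have hq : ((2 * K * r + 1 : ℕ) : ℝ) ≤ 33860 * Λ / L := by
      push_cast
      rw [le_div_iff₀ hL]
      have h1 : (K * L) * r ≤ 62 * (273 * Λ) := by gcongr
      nlinarith
    have hp' : 2 * (p : ℝ) ≤ R * (3 ^ (m + 1 + 1) * ((2 * K * r + 1 : ℕ) : ℝ)) := by exact_mod_cast hp
    have : (R : ℝ) * (3 ^ (m + 1 + 1) * ((2 * K * r + 1 : ℕ) : ℝ)) ≤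
        35 * Δ * (36 / u * (33860 * Λ / L)) := by gcongr
    have e : 35 * Δ * (36 / u * (33860 * Λ / L)) = 42663600 * (1 / (u * L) * Λ * Δ) := by
      field_simp
      ring
    have e2 : 30000000 / (u * L) * Λ * Δ = 30000000 * (1 / (u * L) * Λ * Δ) := by ring
    have h0 : 0 ≤ 1 / (u * L) * Λ * Δ := by positivity
    rw [e2]
    linarith
  have hψ : ∀ a, walshCoeff f a ^ 2 = Real.sin (Real.arcsin |walshCoeff f a|) ^ 2 := fun a => by
    rw [Real.sin_arcsin (by linarith [abs_nonneg (walshCoeff f a)]) (abs_walshCoeff_le_one f a),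
      sq_abs]
  obtain ⟨hlow, hhigh⟩ := hSp f _ hψ
  constructor
  · intro h1 h2
    obtain ⟨a, ha⟩ := exists_abs_walshCoeff_eq f
    have hb := hhigh a (by
      rw [ha]
      refine le_bumpProb hK (h := L / 256) (abs_le.2 ⟨by linarith, by linarith⟩) (by linarith))
    rw [← sq_abs, ha] at hb
    have hM : 2 / Real.pi * (u - L / 128) ≤ walshMax f := by
      have h3 := Real.mul_le_sin (x := u - L / 128) (by linarith) (by linarith)
      refine h3.trans ?_
      rw [← Real.le_arcsin_iff_sin_le ⟨by linarith, by linarith⟩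
        ⟨by linarith [walshMax_pos f], walshMax_le_one f⟩]
      exact h1
    have hr4 : (97 / 100 : ℝ) ^ r ≤ 3 / 4 := by
      refine hr.trans ?_
      rw [div_le_div_iff₀ (by norm_num) (by norm_num)]
      nlinarith
    -- Jordan's inequality gives `walshMax f ≥ 0.6 u`, and the choice of `m` gives `3 ^ (m + 1) > 4
    -- / u`.
    have h5 : Real.pi / 6 / 3 ^ (m + 1) ≤ walshMax f / 2 := by
      have e1 : Real.pi / 6 / 3 ^ (m + 1) ≤ Real.pi / 6 / (4 / u) := by gcongr
      have e2 : Real.pi / 6 / (4 / u) = Real.pi * u / 24 := by field_simp; ring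
      have e3 : 6 / 10 * u ≤ 2 / Real.pi * (u - L / 128) := by
        have h2π : 63 / 100 ≤ 2 / Real.pi := by
          rw [le_div_iff₀ Real.pi_pos]
          linarith
        have h7 := mul_le_mul_of_nonneg_right h2π (by linarith : 0 ≤ u - L / 128)
        linarith
      nlinarith
    have h6 : (Real.pi / 6 / 3 ^ (m + 1)) ^ 2 ≤ flagProb flag z (S f) := by
      have h7 : (Real.pi / 6 / 3 ^ (m + 1)) ^ 2 ≤ (walshMax f / 2) ^ 2 :=
        pow_le_pow_left₀ (by positivity) h5 2
      nlinarith [sq_nonneg (walshMax f)]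
    linarith [(hTp f).2 h6]
  · intro h1
    have hb := hlow fun a => by
      have h2 : Real.arcsin |walshCoeff f a| ≤ Real.arcsin (walshMax f) :=
        Real.arcsin_le_arcsin (abs_walshCoeff_le_walshMax f a)
      refine bumpProb_le hK (D := 253 / 256 * L) (Real.arcsin_nonneg.2 (abs_nonneg _))
        (by linarith) (by positivity) (by linarith) ?_
      rw [show (K : ℝ) * (253 / 256 * L) = 253 / 256 * (K * L) by ring]
      linarith
    have h6 : 9 ^ (m + 1 + 1) * flagProb flag z (S f) ≤ 8 / 1024 := by
      have h7 : (9 : ℝ) ^ (m + 1 + 1) ≤ 1296 / u ^ 2 := by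
        have h8 : (3 : ℝ) ^ (m + 1 + 1) ≤ 36 / u := by
          rw [pow_succ, pow_succ]
          have : 36 / u = 4 / u * 3 * 3 := by ring
          rw [this]
          gcongr
        have e : (9 : ℝ) ^ (m + 1 + 1) = (3 ^ (m + 1 + 1)) ^ 2 := by
          rw [← pow_mul, mul_comm, pow_mul]; norm_num
        have e2 : 1296 / u ^ 2 = (36 / u) ^ 2 := by rw [div_pow]; norm_num
        rw [e, e2]
        exact pow_le_pow_left₀ (by positivity) h8 2
      calc _ ≤ 1296 / u ^ 2 * (u ^ 2 / 2 ^ 18) := by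
            refine mul_le_mul h7 (hb.trans hr) (flagProb_nonneg _ _ _) (by positivity)
        _ ≤ 8 / 1024 := by
            rw [div_mul_div_cancel₀ (by positivity)]
            norm_num
    exact ((hTp f).1 h6).trans hR

/-! ### Search for the non-linearity -/

lemma QState.weight_init (n w : ℕ) : QState.weight (QState.init n w) = 1 := by
  simp [QState.weight, QState.init, Pi.single_apply, apply_ite]

lemma QueryAlgorithm.probFrom_mono {n w : ℕ} (f : (Fin n → Bool) → Bool) {E E' : Set (ℝ × ℕ)}
    (h : E ⊆ E') (A : QueryAlgorithm n w) (ψ : QState n w) (q : ℕ) :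
    A.probFrom f E ψ q ≤ A.probFrom f E' ψ q := by
  induction A generalizing ψ q with
  | halt r =>
    exact Set.indicator_le_indicator_of_subset h
      (fun _ => Finset.sum_nonneg fun _ _ => by positivity) _
  | gate U next ih => exact ih _ _
  | query next ih => exact ih _ _
  | measure k lab next ih => exact Finset.sum_le_sum fun j _ => ih _ _ _

/-- The correct branch `X` is taken with probability at least `1 - d`, and the other branch is only
known to contribute nonnegatively. -/
lemma one_sub_le_mix {P X Y e d : ℝ} (hP0 : 0 ≤ P) (hP1 : P ≤ 1) (hP : 1 - d ≤ P)
    (hX : 1 - e ≤ X) (hY : 0 ≤ Y) (he0 : 0 ≤ e) (he1 : e ≤ 1) (hd : 0 ≤ d) :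
    1 - (e + d) ≤ P * X + (1 - P) * Y := by
  have h1 := mul_le_mul_of_nonneg_left hX hP0
  have h2 := mul_le_mul_of_nonneg_right hP (sub_nonneg.2 he1)
  have h3 := mul_nonneg (sub_nonneg.2 hP1) hY
  have h4 := mul_nonneg hd he0
  linarith

/-- Search for `arcsin (walshMax f)` in an interval of length `ℓ / (127 / 128) ^ m`. -/
lemma exists_search : ∃ C₀ : ℝ, 0 < C₀ ∧ ∀ (n : ℕ) (ℓ δ : ℝ), 0 < ℓ → 0 < δ → δ ≤ 1 / 2 →
    ∀ (m : ℕ) (u : ℝ), ℓ / (127 / 128) ^ m ≤ u → u ≤ Real.pi / 2 →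
    ∃ w₀ : ℕ, ∀ w ≥ w₀, ∃ A : QueryAlgorithm n w, ∀ (f : (Fin n → Bool) → Bool) (q : ℕ) (c : ℝ),
      (q : ℝ) ≤ c → u - ℓ / (127 / 128) ^ m ≤ Real.arcsin (walshMax f) →
      Real.arcsin (walshMax f) ≤ u →
      1 - δ * (1 - (1 / 2) ^ m) ≤ A.probFrom f {p : ℝ × ℕ | |nonlinearity f - p.1| ≤ ℓ ∧
        (p.2 : ℝ) ≤ c + C₀ / ℓ * Real.log (8 / ℓ) * Real.log (2 / δ) / walshMax f *
          ∑ k ∈ Finset.range m, (127 / 128) ^ (k + 1) * ((k : ℝ) + 2)} (QState.init n w) q := by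
  obtain ⟨C₀, hC₀, htest⟩ := exists_test_circuit
  refine ⟨C₀, hC₀, fun n ℓ δ hℓ hδ hδ1 m => ?_⟩
  have hpi' := Real.pi_lt_d2
  induction m with
  | zero =>
    intro u hu hu'
    -- The interval now has length `ℓ`, and the sine is 1-Lipschitz, so its upper end is a
    -- sufficient estimate.
    refine ⟨0, fun w _ => ⟨.halt (1 / 2 - Real.sin u / 2), fun f q c hq h1 h2 => ?_⟩⟩
    rw [QueryAlgorithm.probFrom, Set.indicator_of_mem, QState.weight_init]
    · simp
    · refine ⟨?_, by simpa using hq⟩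
      have hs : Real.sin (Real.arcsin (walshMax f)) = walshMax f :=
        Real.sin_arcsin (by linarith [walshMax_pos f]) (walshMax_le_one f)
      have h3 : |Real.sin u - Real.sin (Real.arcsin (walshMax f))| ≤
          |u - Real.arcsin (walshMax f)| := Real.abs_sin_sub_sin_le _ _
      rw [hs, abs_of_nonneg (sub_nonneg.2 h2)] at h3
      rw [pow_zero, div_one] at h1
      have h4 : nonlinearity f - (1 / 2 - Real.sin u / 2) = (Real.sin u - walshMax f) / 2 := by
        unfold nonlinearity
        ring
      show |nonlinearity f - (1 / 2 - Real.sin u / 2)| ≤ ℓ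
      rw [h4, abs_div, abs_two]
      linarith
  | succ m ih =>
    intro u hu hu'
    set L := ℓ / (127 / 128) ^ (m + 1) with hL
    have hL0 : 0 < L := by positivity
    have hLm : ℓ / (127 / 128) ^ m = 127 / 128 * L := by
      rw [hL, pow_succ]
      field_simp
    have hℓL : ℓ ≤ L := by
      rw [hL, le_div_iff₀ (by positivity)]
      exact mul_le_of_le_one_right hℓ.le (pow_le_one₀ (by norm_num) (by norm_num))
    have hδ' : δ * (1 / 2) ^ (m + 1) ≤ 1 / 2 :=
      (mul_le_of_le_one_right hδ.le (pow_le_one₀ (by norm_num) (by norm_num))).trans hδ1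
    -- Here `m + 1` counts the remaining tests: the cheap test on the widest interval gets the
    -- smallest error budget, the expensive last test the largest.
    obtain ⟨Y, _, _, T, y, flag, _, p, hT, hp, hflag⟩ :=
      htest n u L (δ * (1 / 2) ^ (m + 1)) hL0 hu hu' (by positivity) hδ'
    -- A positive answer drops the bottom piece and keeps `u`; a negative one drops the top piece.
    obtain ⟨w₁, hw₁⟩ := ih u (by rw [hLm]; linarith) hu'
    obtain ⟨w₂, hw₂⟩ := ih (u - L / 128) (by rw [hLm]; linarith) (by linarith)
    refine ⟨max (Fintype.card Y) (max w₁ w₂), fun w hw => ?_⟩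
    obtain ⟨A₁, hA₁⟩ := hw₁ w (by simp at hw; omega)
    obtain ⟨A₂, hA₂⟩ := hw₂ w (by simp at hw; omega)
    obtain ⟨A, hA⟩ := hT.exists_branch () y flag (by simp at hw; omega) A₁ A₂
    refine ⟨A, fun f q c hq h1 h2 => ?_⟩
    have hM := walshMax_pos f
    have hMu : walshMax f ≤ u := by
      have h3 := Real.sin_le (Real.arcsin_nonneg.2 hM.le)
      rw [Real.sin_arcsin (by linarith) (walshMax_le_one f)] at h3
      linarith
    -- The factor `1 / u` is replaced by `1 / walshMax f`, and the shrinking budget costs only the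
    -- factor `m + 2`.
    have hcost : (p : ℝ) ≤ C₀ / ℓ * Real.log (8 / ℓ) * Real.log (2 / δ) / walshMax f *
        ((127 / 128) ^ (m + 1) * ((m : ℝ) + 2)) := by
      have hl1 : 0 ≤ Real.log (8 / L) :=
        Real.log_nonneg (by rw [le_div_iff₀ hL0]; linarith)
      have hl2 : Real.log (8 / L) ≤ Real.log (8 / ℓ) :=
        Real.log_le_log (by positivity) (by gcongr)
      have hl3 : Real.log 2 ≤ Real.log (2 / δ) :=
        Real.log_le_log (by norm_num) (by rw [le_div_iff₀ hδ]; linarith)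
      have hl4 : Real.log (2 / (δ * (1 / 2) ^ (m + 1))) ≤ Real.log (2 / δ) * ((m : ℝ) + 2) := by
        rw [show 2 / (δ * (1 / 2) ^ (m + 1)) = 2 / δ * 2 ^ (m + 1) by
            rw [one_div, inv_pow]; field_simp,
          Real.log_mul (by positivity) (by positivity), Real.log_pow]
        push_cast
        have hm0 : (0 : ℝ) ≤ m := Nat.cast_nonneg m
        nlinarith
      have hl0 : 0 ≤ Real.log (2 / (δ * (1 / 2) ^ (m + 1))) :=
        Real.log_nonneg (by rw [le_div_iff₀ (by positivity)]; linarith)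
      refine hp.trans ?_
      calc C₀ / (u * L) * Real.log (8 / L) * Real.log (2 / (δ * (1 / 2) ^ (m + 1)))
          ≤ C₀ / (walshMax f * L) * Real.log (8 / ℓ) * (Real.log (2 / δ) * ((m : ℝ) + 2)) :=
            mul_le_mul (mul_le_mul (by gcongr) hl2 hl1 (by positivity)) hl4 hl0
              (mul_nonneg (by positivity) (hl1.trans hl2))
        _ = _ := by
            rw [hL]
            field_simp
    set E := {p : ℝ × ℕ | |nonlinearity f - p.1| ≤ ℓ ∧
        (p.2 : ℝ) ≤ c + C₀ / ℓ * Real.log (8 / ℓ) * Real.log (2 / δ) / walshMax f *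
          ∑ k ∈ Finset.range (m + 1), (127 / 128) ^ (k + 1) * ((k : ℝ) + 2)} with hE
    have hc : ((q + p : ℕ) : ℝ) ≤ c + C₀ / ℓ * Real.log (8 / ℓ) * Real.log (2 / δ) / walshMax f *
        ((127 / 128) ^ (m + 1) * ((m : ℝ) + 2)) := by
      push_cast
      linarith
    have hE' : {p : ℝ × ℕ | |nonlinearity f - p.1| ≤ ℓ ∧
        (p.2 : ℝ) ≤ c + C₀ / ℓ * Real.log (8 / ℓ) * Real.log (2 / δ) / walshMax f *
        ((127 / 128) ^ (m + 1) * ((m : ℝ) + 2)) +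
          C₀ / ℓ * Real.log (8 / ℓ) * Real.log (2 / δ) / walshMax f *
          ∑ k ∈ Finset.range m, (127 / 128) ^ (k + 1) * ((k : ℝ) + 2)} = E := by
      have hadd : ∀ B s x : ℝ, c + B * x + B * s = c + B * (s + x) := fun _ _ _ => by ring
      rw [hE, Finset.sum_range_succ, hadd]
    have k₁ := hA₁ f (q + p) _ hc
    have k₂ := hA₂ f (q + p) _ hc
    rw [hE', hLm] at k₁ k₂
    obtain ⟨hhigh, hlow⟩ := hflag f
    rw [hA]
    have hX := A₁.probFrom_nonneg f E (QState.init n w) (q + p)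
    have hY := A₂.probFrom_nonneg f E (QState.init n w) (q + p)
    set X := A₁.probFrom f E (QState.init n w) (q + p)
    set X' := A₂.probFrom f E (QState.init n w) (q + p)
    have hP0 := flagProb_nonneg flag y (T f)
    have hP1 := flagProb_le_one flag (z := y) (hT.mem_unitary () f)
    change _ ≤ flagProb flag y (T f) * X + (1 - flagProb flag y (T f)) * X'
    set P := flagProb flag y (T f)
    have he : δ * (1 - (1 / 2) ^ (m + 1)) = δ * (1 - (1 / 2) ^ m) + δ * (1 / 2) ^ (m + 1) := by
      rw [pow_succ]
      ring
    have hpow : (1 / 2 : ℝ) ^ m ≤ 1 := pow_le_one₀ (by norm_num) (by norm_num)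
    have hpow0 : (0 : ℝ) ≤ (1 / 2) ^ m := by positivity
    have he0 : 0 ≤ δ * (1 - (1 / 2) ^ m) := mul_nonneg hδ.le (by linarith)
    have he1 : δ * (1 - (1 / 2) ^ m) ≤ 1 :=
      (mul_le_of_le_one_right hδ.le (by linarith)).trans (by linarith)
    have hd0 : 0 ≤ δ * (1 / 2) ^ (m + 1) := by positivity
    rw [he]
    set e := δ * (1 - (1 / 2) ^ m)
    set d := δ * (1 / 2) ^ (m + 1)
    rcases le_total (u - L / 128) (Real.arcsin (walshMax f)) with ha | ha
    · exact one_sub_le_mix hP0 hP1 (hhigh ha h2) (k₁ (by linarith) h2) hY he0 he1 hd0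
    · have hX2 := k₂ (by linarith) ha
      rcases le_total (Real.arcsin (walshMax f)) (u - 127 / 128 * L) with hb | hb
      · have := one_sub_le_mix (P := 1 - P) (by linarith) (by linarith) (by linarith [hlow hb]) hX2
          hX he0 he1 hd0
        linarith
      -- In the middle zone both subintervals contain the target, so the test is allowed any answer.
      · have hX1 := mul_le_mul_of_nonneg_left (k₁ hb h2) hP0
        have hX3 := mul_le_mul_of_nonneg_left hX2 (sub_nonneg.2 hP1)
        linarith

/-- With `x = 127 / 128` the full series is `1 / (1 - x) ^ 2 - 1 = 128 ^ 2 - 1`. -/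
lemma sum_pow_mul_le (m : ℕ) :
    ∑ k ∈ Finset.range m, (127 / 128 : ℝ) ^ (k + 1) * ((k : ℝ) + 2) ≤ 16383 := by
  have h : ∑ k ∈ Finset.range m, (127 / 128 : ℝ) ^ (k + 1) * ((k : ℝ) + 2) =
      16383 - (127 / 128) ^ m * (127 * m + 16383) := by
    induction m with
    | zero => simp
    | succ m ih =>
      rw [Finset.sum_range_succ, ih]
      push_cast
      ring
  rw [h]
  have : (0 : ℝ) ≤ (127 / 128) ^ m * (127 * m + 16383) := by positivity
  linarith

theorem mainTheorem7 :
    ∃ C : ℝ, 0 < C ∧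
      ∀ (n : ℕ) (lam δ : ℝ), 0 < lam → lam < 1 → 0 < δ → δ < 1 / 2 →
        ∃ (w : ℕ) (A : QueryAlgorithm n w), ∀ f : (Fin n → Bool) → Bool,
          1 - δ ≤ A.prob f {p : ℝ × ℕ |
            |nonlinearity f - p.1| ≤ lam ∧
            (p.2 : ℝ) ≤ C * (1 / (lam * walshMax f) * Real.log (1 / lam)
              * Real.log (1 / (δ * walshMax f)))} := by
  obtain ⟨C₀, hC₀, hsearch⟩ := exists_search
  refine ⟨200000 * C₀, by positivity, fun n lam δ hlam hlam1 hδ hδ1 => ?_⟩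
  have hloglam : 0 ≤ Real.log (1 / lam) :=
    Real.log_nonneg (by rw [le_div_iff₀ hlam]; linarith)
  have hlogδ : ∀ f : (Fin n → Bool) → Bool,
      Real.log (1 / δ) ≤ Real.log (1 / (δ * walshMax f)) := fun f => by
    have hM := walshMax_pos f
    refine Real.log_le_log (by positivity) ?_
    gcongr
    exact mul_le_of_le_one_right hδ.le (walshMax_le_one f)
  have hlogδ0 : 0 ≤ Real.log (1 / δ) := Real.log_nonneg (by rw [le_div_iff₀ hδ]; linarith)
  -- As `lam` tends to `1` the bound tends to `0`; but the non-linearity lies in `[0, 1/2]`, so for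
  -- `lam ≥ 1/4` the constant `1/4` is output without a query.
  rcases le_or_gt (1 / 4) lam with h4 | h4
  · refine ⟨0, .halt (1 / 4), fun f => ?_⟩
    have hM := walshMax_pos f
    have hM1 := walshMax_le_one f
    rw [QueryAlgorithm.prob, QueryAlgorithm.probFrom, Set.indicator_of_mem, QState.weight_init]
    · linarith
    · have := hlogδ0.trans (hlogδ f)
      refine ⟨?_, by simp only [Nat.cast_zero]; positivity⟩
      refine le_trans ?_ h4
      rw [abs_le]
      unfold nonlinearity
      constructor <;> linarith
  · obtain ⟨m, hm, hm'⟩ := exists_nat_pow_near_of_lt_one (x := lam / 2) (y := 127 / 128)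
      (by positivity) (by linarith) (by norm_num) (by norm_num)
    have hpi := Real.pi_gt_three
    have hpi' := Real.pi_lt_d2
    -- Chosen so that `m + 1` shrinking steps lead exactly from `[0, π / 2]` to length `ℓ`, with
    -- `lam / 2 ≤ ℓ ≤ lam`.
    set ℓ := Real.pi / 2 * (127 / 128) ^ (m + 1) with hℓ
    have hℓ0 : 0 < ℓ := by positivity
    have hℓlam : ℓ ≤ lam := by nlinarith
    have hlamℓ : lam / 2 ≤ ℓ := by
      rw [hℓ, pow_succ]
      nlinarith
    have hint : ℓ / (127 / 128) ^ (m + 1) = Real.pi / 2 := by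
      rw [hℓ, mul_div_cancel_right₀ _ (by positivity)]
    obtain ⟨w, hw⟩ := hsearch n ℓ δ hℓ0 hδ hδ1.le (m + 1) (Real.pi / 2) hint.le le_rfl
    obtain ⟨A, hA⟩ := hw w le_rfl
    refine ⟨w, A, fun f => ?_⟩
    have hM := walshMax_pos f
    have key := hA f 0 0 (by simp) (by
      rw [hint, sub_self]
      exact Real.arcsin_nonneg.2 hM.le) (Real.arcsin_le_pi_div_two _)
    have hδm : 1 - δ ≤ 1 - δ * (1 - (1 / 2) ^ (m + 1)) := by
      have : 0 ≤ δ * (1 / 2) ^ (m + 1) := by positivity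
      linarith
    refine (hδm.trans key).trans (QueryAlgorithm.probFrom_mono f ?_ _ _ _)
    rintro ⟨r, t⟩ ⟨h1, h2⟩
    refine ⟨h1.trans hℓlam, h2.trans ?_⟩
    -- `8 / ℓ ≤ 16 / lam ≤ 1 / lam ^ 3`, where the last step uses `lam < 1 / 4`.
    have l1 : Real.log (8 / ℓ) ≤ 3 * Real.log (1 / lam) := by
      rw [show (3 : ℝ) * Real.log (1 / lam) = (3 : ℕ) * Real.log (1 / lam) by norm_num,
        ← Real.log_pow]
      refine Real.log_le_log (by positivity) ?_
      rw [div_pow, one_pow, div_le_div_iff₀ hℓ0 (by positivity)]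
      have h16 : lam ^ 2 ≤ 1 / 16 := by nlinarith
      have : lam ^ 3 ≤ lam / 16 := by
        rw [pow_succ]
        nlinarith
      linarith
    have l2 : Real.log (2 / δ) ≤ 2 * Real.log (1 / (δ * walshMax f)) := by
      refine le_trans ?_ (mul_le_mul_of_nonneg_left (hlogδ f) two_pos.le)
      rw [show (2 : ℝ) * Real.log (1 / δ) = (2 : ℕ) * Real.log (1 / δ) by norm_num,
        ← Real.log_pow]
      refine Real.log_le_log (by positivity) ?_
      rw [div_pow, one_pow, div_le_div_iff₀ hδ (by positivity)]
      nlinarith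
    have l3 : 0 ≤ Real.log (8 / ℓ) := Real.log_nonneg (by rw [le_div_iff₀ hℓ0]; linarith)
    have l4 : 0 ≤ Real.log (2 / δ) := Real.log_nonneg (by rw [le_div_iff₀ hδ]; linarith)
    have l5 := hlogδ0.trans (hlogδ f)
    have hsum := sum_pow_mul_le (m + 1)
    have hB : C₀ / ℓ * Real.log (8 / ℓ) * Real.log (2 / δ) / walshMax f ≤
        C₀ / (lam / 2) * (3 * Real.log (1 / lam)) * (2 * Real.log (1 / (δ * walshMax f)))
          / walshMax f := by
      gcongr
    rw [zero_add]
    calc _ ≤ C₀ / (lam / 2) * (3 * Real.log (1 / lam)) * (2 * Real.log (1 / (δ * walshMax f)))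
          / walshMax f * 16383 :=
          mul_le_mul hB hsum (Finset.sum_nonneg fun k _ => by positivity) (by positivity)
      -- The constant is `2 * 3 * 2 * 16383`.
      _ = 196596 * C₀ * (1 / (lam * walshMax f) * Real.log (1 / lam)
              * Real.log (1 / (δ * walshMax f))) := by
          field_simp
          ring
      _ ≤ _ := by
          gcongr
          norm_num
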